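/- Let $N\ge 1$ and $d\ge 0$ be integers. All matrices below are real $d\times d$, $'$ denotes transposition, and "positive definite" includes symmetric. A $CM_L$ model on $[0,N]=\{0,1,\dots,N\}$ is given by parameters $(G_{k,k-1},G_{k,N},G_k)$, $1\le k\le N-1$, with every $G_k$ positive definite. An $\mathbb{R}^d$-valued stochastic sequence $[x_k]=(x_0,\dots,x_N)$ is *described* by the model if, almost surely, $$x_k=G_{k,k-1}x_{k-1}+G_{k,N}x_N+e_k,\qquad 1\le k\le N-1,$$ together with a boundary condition of one of the two forms $$x_N=e_N,\quad x_0=G_{0,N}x_N+e_0\qquad\text{or}\qquad x_0=e_0,\quad x_N=G_{N,0}x_0+e_N$$ with an arbitrary matrix $G_{0,N}$ or $G_{N,0}$. Here $(e_0,\dots,e_N)$ is a jointly Gaussian zero-mean sequence of pairwise uncorrelated vectors with nonsingular covariances, where $\mathrm{Cov}(e_k)=G_k$ for $1\le k\le N-1$ and $\mathrm{Cov}(e_0)$, $\mathrm{Cov}(e_N)$ are arbitrary positive definite matrices. A sequence $[x_k]$ is *reciprocal* if for all $0\le j<l\le N$, conditioned on $(x_j,x_l)$, the states $(x_k)_{j<k<l}$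 are independent of the states $(x_k)_{k<j\text{ or }k>l}$. A Markov model $y_k=M_{k,k-1}y_{k-1}+e^M_k$, $1\le k\le N$, is given by parameters $(M_{k,k-1},M_k)$, $1\le k\le N$, where $M_{k,k-1}$ is any matrix and $M_k=\mathrm{Cov}(e^M_k)$ is positive definite. Put $M_{N|N}=I$, $M_{N|k}=M_{N,N-1}\cdots M_{k+1,k}$ and $C_{N|k}=\sum_{n=k}^{N-1}M_{N|n+1}M_{n+1}M_{N|n+1}'$. The $CM_L$ model is *induced* by the Markov model if for every $1\le k\le N-1$ $$G_{k,k-1}=M_{k,k-1}-G_{k,N}M_{N|k}M_{k,k-1},\quad G_{k,N}=G_kM_{N|k}'C_{N|k}^{-1},\quad G_k=\bigl(M_k^{-1}+M_{N|k}'C_{N|k}^{-1}M_{N|k}\bigr)^{-1}.$$ **Corollary.** A $CM_L$ model describes a reciprocal sequence if and only if it is induced by some Markov model. More precisely: there is a reciprocal sequence described by the model iff the model is induced by some Markov model; and any given sequence described by the model (on any probability space, with any boundary condition as above) is reciprocal iff the model is induced by some Markov model. -/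

import Mathlib

open MeasureTheory ProbabilityTheory Matrix

/-!
Stochastic sequences over the time interval `[0, N]` of `d`-dimensional vectors are written as
`x : ℕ → Ω → (Fin d → ℝ)`; only the times `0, …, N` are ever used.  Likewise, parameter sequences
are indexed by `ℕ`, and only the indices in the stated range are ever used.
-/

/-- `m₁` and `m₂` are conditionally independent given `m'` under `P`.  (Mathlib's `CondIndep` is
restricted to standard Borel spaces; the two notions agree there, see the next lemma.) -/
def CondIndepGiven {Ω : Type*} (m' m₁ m₂ : MeasurableSpace Ω) {mΩ : MeasurableSpace Ω}
    (P : Measure Ω) : Prop :=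
  ∀ A B : Set Ω, MeasurableSet[m₁] A → MeasurableSet[m₂] B →
    P⟦A ∩ B | m'⟧ =ᵐ[P] P⟦A | m'⟧ * P⟦B | m'⟧

theorem condIndepGiven_iff_condIndep {Ω : Type*} (m' m₁ m₂ : MeasurableSpace Ω)
    {mΩ : MeasurableSpace Ω} [StandardBorelSpace Ω] (P : Measure Ω) [IsFiniteMeasure P]
    (hm' : m' ≤ mΩ) (hm₁ : m₁ ≤ mΩ) (hm₂ : m₂ ≤ mΩ) :
    CondIndepGiven m' m₁ m₂ P ↔ CondIndep m' m₁ m₂ hm' P :=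
  (condIndep_iff m' m₁ m₂ hm' hm₁ hm₂ P).symm

/-- The σ-algebra generated by the states `x k`, `k ∈ S`. -/
@[reducible]
def sigmaStates {Ω : Type*} {d : ℕ} (x : ℕ → Ω → (Fin d → ℝ)) (S : Set ℕ) : MeasurableSpace Ω :=
  ⨆ k ∈ S, MeasurableSpace.comap (x k) inferInstance

/-- The sequence `[x_k]`, `k ∈ [0, N]`, is reciprocal: conditioned on the states at any two times
`j < l`, the segment inside `(j, l)` is independent of the two segments outside `[j, l]`. -/
def IsReciprocal {Ω : Type*} [MeasurableSpace Ω] (N : ℕ) {d : ℕ} (P : Measure Ω)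
    (x : ℕ → Ω → (Fin d → ℝ)) : Prop :=
  ∀ j l : ℕ, j < l → l ≤ N →
    CondIndepGiven (sigmaStates x {j, l})
      (sigmaStates x {k | j < k ∧ k < l})
      (sigmaStates x {k | k ≤ N ∧ (k < j ∨ l < k)}) P

/-- The covariance matrix `Cov(v)` of a random vector `v`. -/
noncomputable def covMatrix {Ω : Type*} [MeasurableSpace Ω] {d : ℕ} (P : Measure Ω)
    (v : Ω → (Fin d → ℝ)) : Matrix (Fin d) (Fin d) ℝ :=
  Matrix.of fun i j => cov[fun ω => v ω i, fun ω => v ω j; P]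

/-- `[e_k]`, `k ∈ [0, N]`, is a zero-mean white nonsingular Gaussian sequence. -/
structure IsWhiteNG {Ω : Type*} [MeasurableSpace Ω] (N : ℕ) {d : ℕ} (P : Measure Ω)
    (e : ℕ → Ω → (Fin d → ℝ)) : Prop where
  gaussian : HasGaussianLaw (fun ω (k : Fin (N + 1)) => e k ω) P
  mean_zero : ∀ k ≤ N, ∀ i, ∫ ω, e k ω i ∂P = 0
  white : ∀ k ≤ N, ∀ l ≤ N, k ≠ l → ∀ i j, cov[fun ω => e k ω i, fun ω => e l ω j; P] = 0
  nonsingular : ∀ k ≤ N, (covMatrix P (e k)).PosDef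

/-- The parameters `(G_{k,k-1}, G_{k,N}, G_k)`, `k ∈ [1, N-1]`, of a `CM_L` model
`x_k = G_{k,k-1} x_{k-1} + G_{k,N} x_N + e_k`, `Cov(e_k) = G_k`. -/
structure CMLModel (N d : ℕ) where
  /-- `prev k` is `G_{k,k-1}` -/
  prev : ℕ → Matrix (Fin d) (Fin d) ℝ
  /-- `last k` is `G_{k,N}` -/
  last : ℕ → Matrix (Fin d) (Fin d) ℝ
  /-- `noise k` is `G_k` -/
  noise : ℕ → Matrix (Fin d) (Fin d) ℝ
  noise_posDef : ∀ k, 1 ≤ k → k < N → (noise k).PosDef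

/-- The sequence `[x_k]` of random vectors obeys the `CM_L` model, together with a boundary
condition of one of the two usual forms, whose parameters are arbitrary. -/
def CMLModel.Describes {Ω : Type*} [MeasurableSpace Ω] {N d : ℕ} (𝒢 : CMLModel N d)
    (P : Measure Ω) (x : ℕ → Ω → (Fin d → ℝ)) : Prop :=
  (∀ k ≤ N, Measurable (x k)) ∧
  ∃ e : ℕ → Ω → (Fin d → ℝ), IsWhiteNG N P e ∧
    (∀ k, 1 ≤ k → k < N → covMatrix P (e k) = 𝒢.noise k) ∧
    (∀ k, 1 ≤ k → k < N →
      ∀ᵐ ω ∂P, x k ω = 𝒢.prev k *ᵥ x (k - 1) ω + 𝒢.last k *ᵥ x N ω + e k ω) ∧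
    ((∃ G0N : Matrix (Fin d) (Fin d) ℝ,
        (∀ᵐ ω ∂P, x N ω = e N ω) ∧ (∀ᵐ ω ∂P, x 0 ω = G0N *ᵥ x N ω + e 0 ω)) ∨
     (∃ GN0 : Matrix (Fin d) (Fin d) ℝ,
        (∀ᵐ ω ∂P, x 0 ω = e 0 ω) ∧ (∀ᵐ ω ∂P, x N ω = GN0 *ᵥ x 0 ω + e N ω)))

/-- The parameters `(M_{k,k-1}, M_k)`, `k ∈ [1, N]`, of a Markov model
`y_k = M_{k,k-1} y_{k-1} + e_k`, `Cov(e_k) = M_k`. -/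
structure MarkovModel (N d : ℕ) where
  /-- `prev k` is `M_{k,k-1}` -/
  prev : ℕ → Matrix (Fin d) (Fin d) ℝ
  /-- `noise k` is `M_k` -/
  noise : ℕ → Matrix (Fin d) (Fin d) ℝ
  noise_posDef : ∀ k, 1 ≤ k → k ≤ N → (noise k).PosDef

namespace MarkovModel

variable {N d : ℕ}

/-- The `n`-step transition matrix `M_{k+n,k+n-1} ⋯ M_{k+1,k}`. -/
def steps (M : MarkovModel N d) (k : ℕ) : ℕ → Matrix (Fin d) (Fin d) ℝ
  | 0 => 1
  | n + 1 => M.prev (k + n + 1) * M.steps k n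

/-- `M_{N|k} = M_{N,N-1} ⋯ M_{k+1,k}`, with `M_{N|N} = I`. -/
def toLast (M : MarkovModel N d) (k : ℕ) : Matrix (Fin d) (Fin d) ℝ :=
  M.steps k (N - k)

/-- `C_{N|k} = ∑_{n=k}^{N-1} M_{N|n+1} M_{n+1} M_{N|n+1}'`. -/
def covToLast (M : MarkovModel N d) (k : ℕ) : Matrix (Fin d) (Fin d) ℝ :=
  ∑ n ∈ Finset.Ico k N, M.toLast (n + 1) * M.noise (n + 1) * (M.toLast (n + 1))ᵀ

end MarkovModel

/-- The `CM_L` model is the one induced by the Markov model `M`. -/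
def CMLModel.IsInducedBy {N d : ℕ} (𝒢 : CMLModel N d) (M : MarkovModel N d) : Prop :=
  ∀ k, 1 ≤ k → k < N →
    𝒢.prev k = M.prev k - 𝒢.last k * M.toLast k * M.prev k ∧
    𝒢.last k = 𝒢.noise k * (M.toLast k)ᵀ * (M.covToLast k)⁻¹ ∧
    𝒢.noise k = ((M.noise k)⁻¹ + (M.toLast k)ᵀ * (M.covToLast k)⁻¹ * M.toLast k)⁻¹

/-! ### Integrals and conditional expectations over a join of two σ-algebras -/

section SupSigmaAlgebra

variable {Ω : Type*} {m₁ m₂ m₃ mΩ : MeasurableSpace Ω} {P : Measure Ω}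

/-! Both sides are equivalent to one algebraic condition on the model. Write H_k = G_k⁻¹ G_{k,N};
then `IsCompatible` says H_k = G_{k+1,k}' H_{k+1} for 1 ≤ k ≤ N - 2.

Reciprocity: the equations read F x = e with F invertible, so x is Gaussian with precision matrix F'
S⁻¹ F, S being the block diagonal covariance of e. By `condIndepGiven_iff_precision_eq_zero`,
reciprocity means that its blocks (k, m) vanish whenever k lies strictly inside and m strictly
outside some [j, l]. In an interior column of F only rows k and k+1 are nonzero, and neither
contains a boundary matrix. Hence only the blocks (k, N) with k ≤ N - 2 can fail to vanish, and
their vanishing is compatibility (`Describes.isReciprocal_iff`). The criterion involves neither the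
sequence nor its boundary condition.

Induced models: if a Markov model induces the parameters, then H_k = M_{N|k}' C_{N|k}⁻¹, and the
one-step recursions for M_{N|k} and C_{N|k} with the Woodbury identity give compatibility.
Conversely, let x_N given x_0 have covariance I and mean H_1' G_{1,0} x_0 (when N ≥ 2). Each x_k -
G_{k,k-1} x_{k-1} = G_{k,N} x_N + e_k is then a new observation of x_N, which raises its precision
by H_k' G_k H_k. Compatibility makes the conditional mean of x_N depend on x_k alone; the resulting
chain is `toMarkov`.

For the first equivalence it remains that every model describes some sequence (`exists_describes`).
-/

theorem sup_eq_generateFrom_inter (m₁ m₂ : MeasurableSpace Ω) :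
    m₁ ⊔ m₂ = MeasurableSpace.generateFrom
      (Set.image2 (· ∩ ·) {s | MeasurableSet[m₁] s} {t | MeasurableSet[m₂] t}) := by
  refine le_antisymm (sup_le (fun s hs => ?_) (fun s hs => ?_))
    (MeasurableSpace.generateFrom_le ?_)
  · exact MeasurableSpace.measurableSet_generateFrom
      ⟨s, hs, Set.univ, MeasurableSet.univ, Set.inter_univ s⟩
  · exact MeasurableSpace.measurableSet_generateFrom
      ⟨Set.univ, MeasurableSet.univ, s, hs, Set.univ_inter s⟩
  · rintro _ ⟨s, hs, t, ht, rfl⟩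
    exact @MeasurableSet.inter _ (m₁ ⊔ m₂) _ _ ((le_sup_left : m₁ ≤ m₁ ⊔ m₂) s hs)
      ((le_sup_right : m₂ ≤ m₁ ⊔ m₂) t ht)

theorem isPiSystem_image2_inter (m₁ m₂ : MeasurableSpace Ω) :
    IsPiSystem (Set.image2 (· ∩ ·) {s | MeasurableSet[m₁] s} {t | MeasurableSet[m₂] t}) := by
  rintro _ ⟨s, hs, t, ht, rfl⟩ _ ⟨s', hs', t', ht', rfl⟩ -
  exact ⟨s ∩ s', @MeasurableSet.inter _ m₁ _ _ hs hs', t ∩ t',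
    @MeasurableSet.inter _ m₂ _ _ ht ht', Set.inter_inter_inter_comm s s' t t'⟩

/-- A function whose integrals over the intersections `s ∩ t` vanish has vanishing integrals over
the sets of the generated σ-algebra. -/
theorem setIntegral_eq_zero_of_sup (h₁ : m₁ ≤ mΩ) (h₂ : m₂ ≤ mΩ) {g : Ω → ℝ}
    (hg : Integrable g P)
    (h : ∀ s t, MeasurableSet[m₁] s → MeasurableSet[m₂] t → ∫ ω in s ∩ t, g ω ∂P = 0)
    (s : Set Ω) (hs : MeasurableSet[m₁ ⊔ m₂] s) : ∫ ω in s, g ω ∂P = 0 := by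
  have hle : m₁ ⊔ m₂ ≤ mΩ := sup_le h₁ h₂
  have huniv : ∫ ω, g ω ∂P = 0 := by
    simpa using h Set.univ Set.univ MeasurableSet.univ MeasurableSet.univ
  induction s, hs using MeasurableSpace.induction_on_inter (sup_eq_generateFrom_inter m₁ m₂)
    (isPiSystem_image2_inter m₁ m₂) with
  | empty => simp
  | basic t ht =>
    obtain ⟨s, hs, t, ht, rfl⟩ := ht
    exact h s t hs ht
  | compl t htm ih =>
    have := integral_add_compl (hle t htm) hg
    linarith
  | iUnion f hd hf ih =>
    rw [integral_iUnion (fun i => hle _ (hf i)) hd hg.integrableOn]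
    simp [ih]

/-- Conditioning additionally on a σ-algebra independent of everything else has no effect. -/
theorem condExp_sup_of_indep [IsProbabilityMeasure P] (h₁ : m₁ ≤ mΩ) (h₂ : m₂ ≤ mΩ)
    (h₃ : m₃ ≤ mΩ) (h₁₂ : m₁ ≤ m₂) (hind : Indep m₃ m₂ P) {f : Ω → ℝ}
    (hf : StronglyMeasurable[m₂] f) (hfi : Integrable f P) :
    P[f | m₁ ⊔ m₃] =ᵐ[P] P[f | m₁] := by
  have key : ∀ s t, MeasurableSet[m₁] s → MeasurableSet[m₃] t →
      ∫ ω in s ∩ t, (P[f | m₁] - f) ω ∂P = 0 := by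
    intro s t hs ht
    set g := s.indicator (P[f | m₁] - f) with hg
    have hgm : StronglyMeasurable[m₂] g :=
      ((stronglyMeasurable_condExp.mono h₁₂).sub hf).indicator (h₁₂ s hs)
    have hgi : Integrable g P := (integrable_condExp.sub hfi).indicator (h₁ s hs)
    have h0 : ∫ ω, g ω ∂P = 0 := by
      rw [hg, integral_indicator (h₁ s hs)]
      simp only [Pi.sub_apply]
      rw [integral_sub integrable_condExp.integrableOn hfi.integrableOn,
        setIntegral_condExp h₁ hfi hs, sub_self]
    have h1 := condExp_indep_eq h₂ h₃ hgm hind.symm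
    rw [Set.inter_comm, ← setIntegral_indicator (h₁ s hs), ← hg,
      ← setIntegral_condExp h₃ hgi ht,
      setIntegral_congr_ae (h₃ t ht) (h1.mono fun ω hω _ => hω), h0]
    simp
  have hm : StronglyMeasurable[m₁ ⊔ m₃] (P[f | m₁]) := stronglyMeasurable_condExp.mono le_sup_left
  refine (ae_eq_condExp_of_forall_setIntegral_eq (sup_le h₁ h₃) hfi
    (fun _ _ _ => integrable_condExp.integrableOn) (fun s hs _ => ?_)
    hm.aestronglyMeasurable).symm
  have := setIntegral_eq_zero_of_sup h₁ h₃ (integrable_condExp.sub hfi) key s hs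
  simp only [Pi.sub_apply] at this
  rwa [integral_sub integrable_condExp.integrableOn hfi.integrableOn, sub_eq_zero] at this

end SupSigmaAlgebra

/-! ### Conditional independence and conditional expectations -/

section CondIndepGiven

variable {Ω : Type*} {m' m₁ m₂ m₃ mΩ : MeasurableSpace Ω} {P : Measure Ω}

theorem indicator_one_inter_eq_mul (A B : Set Ω) :
    (A ∩ B).indicator (fun _ => (1 : ℝ)) = A.indicator (fun _ => 1) * B.indicator fun _ => 1 := by
  ext ω
  by_cases hA : ω ∈ A <;> by_cases hB : ω ∈ B <;> simp [hA, hB]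

theorem norm_indicator_one_le (A : Set Ω) (ω : Ω) :
    ‖A.indicator (fun _ => (1 : ℝ)) ω‖ ≤ 1 := by
  by_cases hA : ω ∈ A <;> simp [hA]

theorem condExp_indicator_one_mul [IsProbabilityMeasure P] (h' : m' ≤ mΩ) {A : Set Ω}
    (hA : MeasurableSet[m'] A) {g : Ω → ℝ} (hg : Integrable g P) :
    P[A.indicator (fun _ => (1 : ℝ)) * g | m'] =ᵐ[P] A.indicator (fun _ => 1) * P[g | m'] :=
  condExp_stronglyMeasurable_mul_of_bound h' (stronglyMeasurable_const.indicator hA) hg 1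
    (Filter.Eventually.of_forall (norm_indicator_one_le A))

theorem condExp_mul_condExp [IsProbabilityMeasure P] {A B : Set Ω} (hA : MeasurableSet A) :
    P[A.indicator (fun _ => (1 : ℝ)) * P⟦B | m'⟧ | m'] =ᵐ[P] P⟦A | m'⟧ * P⟦B | m'⟧ := by
  refine condExp_mul_of_stronglyMeasurable_right stronglyMeasurable_condExp ?_
    ((integrable_const 1).indicator hA)
  exact (integrable_condExp).bdd_mul (c := 1)
    ((stronglyMeasurable_const.indicator hA).aestronglyMeasurable)
    (Filter.Eventually.of_forall (norm_indicator_one_le A))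

/-- If `m₃` is independent of `m' ⊔ m₂`, then every sub-σ-algebra of `m' ⊔ m₃` is conditionally
independent of `m₂` given `m'`. -/
theorem condIndepGiven_of_indep [IsProbabilityMeasure P] (h' : m' ≤ mΩ) (h₂ : m₂ ≤ mΩ)
    (h₃ : m₃ ≤ mΩ) (hind : Indep m₃ (m' ⊔ m₂) P) (h₁ : m₁ ≤ m' ⊔ m₃) :
    CondIndepGiven m' m₁ m₂ P := by
  intro A B hA hB
  have hA' : MeasurableSet[m' ⊔ m₃] A := h₁ A hA
  have hAm : MeasurableSet A := (sup_le h' h₃) A hA'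
  have hBm : MeasurableSet B := h₂ B hB
  have hBi : Integrable (B.indicator fun _ => (1 : ℝ)) P := (integrable_const 1).indicator hBm
  have h1 : P⟦B | m' ⊔ m₃⟧ =ᵐ[P] P⟦B | m'⟧ :=
    condExp_sup_of_indep h' (sup_le h' h₂) h₃ le_sup_left hind
      (stronglyMeasurable_const.indicator ((le_sup_right : m₂ ≤ m' ⊔ m₂) B hB)) hBi
  rw [indicator_one_inter_eq_mul]
  calc P[A.indicator (fun _ => (1 : ℝ)) * B.indicator (fun _ => 1) | m']
      =ᵐ[P] P[P[A.indicator (fun _ => (1 : ℝ)) * B.indicator (fun _ => 1) | m' ⊔ m₃] | m'] :=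
        (condExp_condExp_of_le le_sup_left (sup_le h' h₃)).symm
    _ =ᵐ[P] P[A.indicator (fun _ => (1 : ℝ)) * P⟦B | m'⟧ | m'] := by
        refine condExp_congr_ae ((condExp_indicator_one_mul (sup_le h' h₃) hA' hBi).trans ?_)
        filter_upwards [h1] with ω hω
        simp [hω]
    _ =ᵐ[P] P⟦A | m'⟧ * P⟦B | m'⟧ := condExp_mul_condExp hAm

/-- Tested on `s ∩ t`, both candidates reduce to integrals over `s` of conditional expectations
given `m'`. These agree because `1_t P(A | m')` and `1_t 1_A` both project to `P(t | m') P(A | m')`.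
-/
theorem CondIndepGiven.condExp_sup_indicator [IsProbabilityMeasure P]
    (h : CondIndepGiven m' m₁ m₂ P) (h' : m' ≤ mΩ) (h₁ : m₁ ≤ mΩ) (h₂ : m₂ ≤ mΩ) {A : Set Ω}
    (hA : MeasurableSet[m₁] A) : P⟦A | m' ⊔ m₂⟧ =ᵐ[P] P⟦A | m'⟧ := by
  have hAm := h₁ A hA
  have hAi : Integrable (A.indicator fun _ => (1 : ℝ)) P := (integrable_const 1).indicator hAm
  have key : ∀ s t, MeasurableSet[m'] s → MeasurableSet[m₂] t →
      ∫ ω in s ∩ t, (P⟦A | m'⟧ - A.indicator fun _ => (1 : ℝ)) ω ∂P = 0 := by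
    intro s t hs ht
    have htm := h₂ t ht
    simp only [Pi.sub_apply]
    rw [integral_sub integrable_condExp.integrableOn hAi.integrableOn, sub_eq_zero]
    have e : ∀ f : Ω → ℝ, Integrable f P → ∫ ω in s ∩ t, f ω ∂P =
        ∫ ω in s, (P[t.indicator (fun _ => (1 : ℝ)) * f | m']) ω ∂P := by
      intro f hf
      have ht1 : t.indicator (fun _ => (1 : ℝ)) * f = t.indicator f := by
        ext ω; by_cases hω : ω ∈ t <;> simp [hω]
      rw [ht1, setIntegral_condExp h' (hf.indicator htm) hs, setIntegral_indicator htm]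
    rw [e _ integrable_condExp, e _ hAi]
    refine setIntegral_congr_ae (h' s hs) ?_
    filter_upwards [condExp_mul_condExp htm, h A t hA ht] with ω h1 h2 _
    rw [← indicator_one_inter_eq_mul, Set.inter_comm, h2, h1]
    simp [mul_comm]
  have hm : StronglyMeasurable[m' ⊔ m₂] (P⟦A | m'⟧) := stronglyMeasurable_condExp.mono le_sup_left
  refine (ae_eq_condExp_of_forall_setIntegral_eq (sup_le h' h₂) hAi
    (fun _ _ _ => integrable_condExp.integrableOn) (fun s hs _ => ?_)
    hm.aestronglyMeasurable).symm
  have := setIntegral_eq_zero_of_sup h' h₂ (integrable_condExp.sub hAi) key s hs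
  simp only [Pi.sub_apply] at this
  rwa [integral_sub integrable_condExp.integrableOn hAi.integrableOn, sub_eq_zero] at this

/-- Under conditional independence given `m'`, conditioning an `m₁`-measurable function
additionally on `m₂` has no effect. -/
theorem CondIndepGiven.condExp_sup [IsProbabilityMeasure P]
    (h : CondIndepGiven m' m₁ m₂ P) (h' : m' ≤ mΩ) (h₁ : m₁ ≤ mΩ) (h₂ : m₂ ≤ mΩ) {f : Ω → ℝ}
    (hf : AEStronglyMeasurable[m₁] f P) (hfi : Integrable f P) :
    P[f | m' ⊔ m₂] =ᵐ[P] P[f | m'] := by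
  rw [← memLp_one_iff_integrable] at hfi
  refine MemLp.induction_stronglyMeasurable h₁ ENNReal.one_ne_top
    (fun f => P[f | m' ⊔ m₂] =ᵐ[P] P[f | m']) ?_ ?_ ?_ ?_ hfi hf
  · intro c s hs _
    have hc : s.indicator (fun _ => c) = c • s.indicator fun _ => (1 : ℝ) := by
      ext ω; by_cases hω : ω ∈ s <;> simp [hω]
    rw [hc]
    refine (condExp_smul c _ _).trans (Filter.EventuallyEq.trans ?_ (condExp_smul c _ _).symm)
    filter_upwards [h.condExp_sup_indicator h' h₁ h₂ hs] with ω hω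
    simp [hω]
  · intro f g _ hf hg _ _ hfe hge
    rw [memLp_one_iff_integrable] at hf hg
    refine (condExp_add hf hg _).trans (Filter.EventuallyEq.trans ?_ (condExp_add hf hg _).symm)
    exact hfe.add hge
  · have heq : {f : lpMeas ℝ ℝ m₁ 1 P | P[(f : Ω → ℝ) | m' ⊔ m₂] =ᵐ[P] P[(f : Ω → ℝ) | m']} =
        {f : lpMeas ℝ ℝ m₁ 1 P | condExpL1CLM ℝ (sup_le h' h₂) P (f : Lp ℝ 1 P) =
          condExpL1CLM ℝ h' P (f : Lp ℝ 1 P)} := by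
      ext f
      have hfi : Integrable ((f : Lp ℝ 1 P) : Ω → ℝ) P := L1.integrable_coeFn _
      have e1 := condExp_ae_eq_condExpL1CLM (sup_le h' h₂) hfi
      have e2 := condExp_ae_eq_condExpL1CLM h' hfi
      rw [Integrable.toL1_coeFn] at e1 e2
      simp only [Set.mem_ofPred_eq]
      rw [Lp.ext_iff]
      exact ⟨fun he => (e1.symm.trans he).trans e2, fun he => (e1.trans he).trans e2.symm⟩
    rw [heq]
    exact isClosed_eq
      ((ContinuousLinearMap.continuous _).comp (ContinuousLinearMap.continuous
        (Submodule.subtypeL _)))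
      ((ContinuousLinearMap.continuous _).comp (ContinuousLinearMap.continuous
        (Submodule.subtypeL _)))
  · intro f g hfg _ hfe
    exact (condExp_congr_ae hfg.symm).trans (hfe.trans (condExp_congr_ae hfg))

end CondIndepGiven

/-! ### Precision matrices and conditional independence of Gaussian blocks -/

section Gaussian

variable {Ω ι : Type*} {mΩ : MeasurableSpace Ω} {P : Measure Ω}

/-- The σ-algebra generated by the coordinates `X i`, `i ∈ S`, of a random vector. -/
@[reducible]
def sigmaCoords {ι : Type*} (X : Ω → ι → ℝ) (S : Set ι) : MeasurableSpace Ω :=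
  ⨆ i ∈ S, MeasurableSpace.comap (fun ω => X ω i) inferInstance

theorem comap_pi_eq_iSup {κ : Type*} {β : κ → Type*} [∀ k, MeasurableSpace (β k)]
    (Y : (k : κ) → Ω → β k) :
    MeasurableSpace.comap (fun ω k => Y k ω) MeasurableSpace.pi =
      ⨆ k, MeasurableSpace.comap (Y k) inferInstance := by
  simp only [MeasurableSpace.pi, MeasurableSpace.comap_iSup, MeasurableSpace.comap_comp]
  rfl

theorem comap_restrict_eq_sigmaCoords (X : Ω → ι → ℝ) (S : Set ι) :
    MeasurableSpace.comap (fun ω (i : S) => X ω i) MeasurableSpace.pi = sigmaCoords X S := by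
  rw [comap_pi_eq_iSup (fun (i : S) ω => X ω i), iSup_subtype]

theorem sigmaCoords_le {X : Ω → ι → ℝ} (hX : Measurable X) (S : Set ι) :
    sigmaCoords X S ≤ mΩ :=
  iSup₂_le fun i _ => ((measurable_pi_apply i).comp hX).comap_le

theorem measurable_sigmaCoords (X : Ω → ι → ℝ) {S : Set ι} {i : ι} (hi : i ∈ S) :
    Measurable[sigmaCoords X S] fun ω => X ω i :=
  measurable_iff_comap_le.2 (le_iSup₂_of_le i hi le_rfl)

theorem sigmaCoords_union (X : Ω → ι → ℝ) (S T : Set ι) :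
    sigmaCoords X (S ∪ T) = sigmaCoords X S ⊔ sigmaCoords X T :=
  iSup_union

theorem measurable_sum_indicator_mul [Fintype ι] (X : Ω → ι → ℝ) (S : Set ι) (a : ι → ℝ) :
    Measurable[sigmaCoords X S] fun ω => ∑ j, S.indicator a j * X ω j := by
  refine Finset.measurable_sum _ fun j _ => ?_
  by_cases hj : j ∈ S
  · exact (measurable_sigmaCoords X hj).const_mul _
  · simp only [Set.indicator_of_notMem hj, zero_mul]
    exact measurable_const

/-- The matrix of the covariances of the coordinates of a random vector. -/
noncomputable def coordCov {ι : Type*} (P : Measure Ω) (X : Ω → ι → ℝ) : Matrix ι ι ℝ :=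
  Matrix.of fun i j => cov[fun ω => X ω i, fun ω => X ω j; P]

theorem memLp_two_coord [Fintype ι] {X : Ω → ι → ℝ} (hX : HasGaussianLaw X P) (i : ι) :
    MemLp (fun ω => X ω i) 2 P :=
  (HasGaussianLaw.eval (X := fun i ω => X ω i) hX i).memLp_two

theorem covariance_congr_right {Y Z Z' : Ω → ℝ} (h : Z =ᵐ[P] Z') :
    cov[Y, Z; P] = cov[Y, Z'; P] := by
  simp only [covariance]
  rw [integral_congr_ae h]
  refine integral_congr_ae ?_
  filter_upwards [h] with ω hω
  rw [hω]

theorem coordCov_mulVec [Fintype ι] {κ l : Type*} [IsFiniteMeasure P] {X : Ω → ι → ℝ}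
    (hX : ∀ i, MemLp (fun ω => X ω i) 2 P) (A : Matrix κ ι ℝ) (B : Matrix l ι ℝ) (i : κ) (j : l) :
    cov[fun ω => (A *ᵥ X ω) i, fun ω => (B *ᵥ X ω) j; P] = (A * coordCov P X * Bᵀ) i j := by
  simp only [mulVec, dotProduct]
  rw [covariance_fun_sum_fun_sum (fun k => (hX k).const_mul _) (fun k => (hX k).const_mul _)]
  simp only [covariance_const_mul_left, covariance_const_mul_right, mul_apply, coordCov, of_apply,
    transpose_apply, Finset.sum_mul]
  rw [Finset.sum_comm]
  refine Finset.sum_congr rfl fun a _ => Finset.sum_congr rfl fun b _ => by ring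

/-- Let `A` be the precision matrix of the Gaussian vector `X`.  The coordinates of `A X` in `S`
are independent of the coordinates of `X` outside `S`. -/
theorem indep_precision_mulVec [Fintype ι] [DecidableEq ι] {X : Ω → ι → ℝ} (hX : HasGaussianLaw X P)
    {A : Matrix ι ι ℝ} (hA : A * coordCov P X = 1) {S T : Set ι} (hST : Disjoint S T) :
    Indep (sigmaCoords (fun ω => A *ᵥ X ω) S) (sigmaCoords X T) P := by
  have := hX.isProbabilityMeasure
  rw [← comap_restrict_eq_sigmaCoords, ← comap_restrict_eq_sigmaCoords]
  refine HasGaussianLaw.indepFun_of_covariance_eval (X := fun (i : S) ω => (A *ᵥ X ω) i)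
    (Y := fun (j : T) ω => X ω j) ?_ ?_
  · let L : (ι → ℝ) →L[ℝ] (ι → ℝ) := LinearMap.toContinuousLinearMap A.mulVecLin
    classical
    exact hX.map_fun (F := (S → ℝ) × (T → ℝ))
      ((ContinuousLinearMap.pi fun i : S => ContinuousLinearMap.proj (i : ι) ∘L L).prod
        (ContinuousLinearMap.pi fun j : T => ContinuousLinearMap.proj (j : ι)))
  · intro i j
    -- Cov(A X, X) = A Cov(X) = I, and only off-diagonal entries occur for disjoint index sets.
    have h := coordCov_mulVec (memLp_two_coord hX) A (1 : Matrix ι ι ℝ) i j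
    simp only [one_mulVec] at h
    rw [h, hA, transpose_one, mul_one, one_apply_ne]
    rintro hij
    exact Set.disjoint_left.1 hST i.2 (hij ▸ j.2)

/-- Conditional independence of two blocks of a nonsingular Gaussian vector given all other
coordinates means that the corresponding block of the precision matrix vanishes. -/
theorem condIndepGiven_iff_precision_eq_zero [Fintype ι] [DecidableEq ι] {X : Ω → ι → ℝ} (hXm : Measurable X)
    (hX : HasGaussianLaw X P) {A : Matrix ι ι ℝ} (hpd : A.PosDef) (hA : A * coordCov P X = 1)
    {I V W : Set ι} (hIV : Disjoint I V) (hIW : Disjoint I W) (hVW : Disjoint V W)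
    (hcover : ∀ i, i ∈ I ∨ i ∈ V ∨ i ∈ W) :
    CondIndepGiven (sigmaCoords X W) (sigmaCoords X I) (sigmaCoords X V) P ↔
      ∀ i ∈ I, ∀ v ∈ V, A i v = 0 := by
  have := hX.isProbabilityMeasure
  have hRm : Measurable fun ω => A *ᵥ X ω :=
    (LinearMap.continuous_of_finiteDimensional A.mulVecLin).measurable.comp hXm
  have hdecomp : ∀ i ω, (A *ᵥ X ω) i = ∑ j, I.indicator (A i) j * X ω j +
      ∑ j, V.indicator (A i) j * X ω j + ∑ j, W.indicator (A i) j * X ω j := by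
    intro i ω
    rw [← Finset.sum_add_distrib, ← Finset.sum_add_distrib]
    refine Finset.sum_congr rfl fun j _ => ?_
    rcases hcover j with hj | hj | hj
    · simp [hj, Set.disjoint_left.1 hIV hj, Set.disjoint_left.1 hIW hj]
    · simp [hj, Set.disjoint_right.1 hIV hj, Set.disjoint_left.1 hVW hj]
    · simp [hj, Set.disjoint_right.1 hIW hj, Set.disjoint_right.1 hVW hj]
  have hlin : ∀ (S : Set ι) (a : ι → ℝ), MemLp (fun ω => ∑ j, S.indicator a j * X ω j) 2 P :=
    fun S a => memLp_finsetSum _ fun j _ => (memLp_two_coord hX j).const_mul _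
  constructor
  · intro h i hi v hv
    -- Row `i` of A X splits as `f I + f V + f W` and is independent of the coordinates in V ∪ W.
    -- Conditioning on these, and dropping V by hypothesis, makes `f V` a.e. equal to a function `g`
    -- of the W-coordinates. Since (A X)_v is independent of `g`, its covariance with `f V`, which
    -- is A_{iv}, is zero.
    set f : Set ι → Ω → ℝ := fun S ω => ∑ j, S.indicator (A i) j * X ω j with hf
    have hfi : ∀ S, Integrable (f S) P := fun S => (hlin S (A i)).integrable one_le_two
    have hVW_le := sup_le (sigmaCoords_le hXm W) (sigmaCoords_le hXm V)
    have hfm : ∀ S, StronglyMeasurable[sigmaCoords X S] (f S) :=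
      fun S => (measurable_sum_indicator_mul X S (A i)).stronglyMeasurable
    have hr : (fun ω => (A *ᵥ X ω) i) = f I + (f V + f W) := by
      ext ω; simp only [hdecomp, Pi.add_apply, hf]; ring
    have h1 : P[fun ω => (A *ᵥ X ω) i | sigmaCoords X W ⊔ sigmaCoords X V] =ᵐ[P]
        fun _ => P[fun ω => (A *ᵥ X ω) i] := by
      refine condExp_indep_eq (sigmaCoords_le hRm {i}) hVW_le
        (measurable_sigmaCoords _ (Set.mem_singleton i)).stronglyMeasurable ?_
      rw [← sigmaCoords_union]
      exact indep_precision_mulVec hX hA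
        (Set.disjoint_singleton_left.2 fun hi' => hi'.elim (Set.disjoint_left.1 hIW hi)
          (Set.disjoint_left.1 hIV hi))
    have h2 := h.condExp_sup (sigmaCoords_le hXm W) (sigmaCoords_le hXm I) (sigmaCoords_le hXm V)
      (hfm I).aestronglyMeasurable (hfi I)
    have hVWm : StronglyMeasurable[sigmaCoords X W ⊔ sigmaCoords X V] (f V + f W) :=
      ((hfm V).mono le_sup_right).add ((hfm W).mono le_sup_left)
    have h3 := condExp_add (hfi I) ((hfi V).add (hfi W)) (sigmaCoords X W ⊔ sigmaCoords X V)
    rw [condExp_of_stronglyMeasurable hVW_le hVWm ((hfi V).add (hfi W)), ← hr] at h3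
    set g : Ω → ℝ := fun ω => P[fun ω => (A *ᵥ X ω) i] - (P[f I | sigmaCoords X W]) ω - f W ω
      with hg
    have hgm : Measurable[sigmaCoords X W] g :=
      ((stronglyMeasurable_const.sub stronglyMeasurable_condExp).sub (hfm W)).measurable
    have hfg : f V =ᵐ[P] g := by
      filter_upwards [h1, h2, h3] with ω h1 h2 h3
      simp only [Pi.add_apply] at h3
      simp only [hg]
      linarith
    have hind : IndepFun (fun ω => (A *ᵥ X ω) v) g P := by
      have h4 : Indep (sigmaCoords (fun ω => A *ᵥ X ω) {v}) (sigmaCoords X W) P :=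
        indep_precision_mulVec hX hA (Set.disjoint_singleton_left.2 (Set.disjoint_left.1 hVW hv))
      rw [IndepFun_iff_Indep]
      refine indep_of_indep_of_le_left (indep_of_indep_of_le_right h4 hgm.comap_le) ?_
      exact (measurable_sigmaCoords (fun ω => A *ᵥ X ω) (Set.mem_singleton v)).comap_le
    have hrv : MemLp (fun ω => (A *ᵥ X ω) v) 2 P := by
      simp only [mulVec, dotProduct]
      exact memLp_finsetSum _ fun j _ => (memLp_two_coord hX j).const_mul _
    have h5 : cov[fun ω => (A *ᵥ X ω) v, f V; P] = 0 := by
      rw [covariance_congr_right hfg]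
      exact hind.covariance_eq_zero hrv ((hlin V (A i)).ae_eq hfg)
    have h6 := coordCov_mulVec (memLp_two_coord hX) A
      (Matrix.of fun (_ : Unit) => V.indicator (A i)) v ()
    rw [hA, Matrix.one_mul] at h6
    have h7 : cov[fun ω => (A *ᵥ X ω) v, f V; P] = A i v := by
      refine Eq.trans h6 ?_
      simp [hv]
    rw [← h7, h5]
  · intro h
    refine condIndepGiven_of_indep (m₃ := sigmaCoords (fun ω => A *ᵥ X ω) I) (sigmaCoords_le hXm W)
      (sigmaCoords_le hXm V) (sigmaCoords_le hRm I) ?_ ?_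
    · rw [← sigmaCoords_union]
      exact indep_precision_mulVec hX hA (Set.disjoint_union_right.2 ⟨hIW, hIV⟩)
    · refine iSup₂_le fun i hi => measurable_iff_comap_le.1 ?_
      classical
      -- With A_{IV} = 0, the equation A_{II} X_I = (A X)_I - A_{IW} X_W can be solved for X_I, as a
      -- principal block of a positive definite matrix is invertible.
      set B : Matrix I I ℝ := A.submatrix (fun i : I => (i : ι)) (fun i : I => (i : ι)) with hB
      have hBpd : B.PosDef := hpd.submatrix Subtype.val_injective
      have hBu : IsUnit B.det := hBpd.det_pos.ne'.isUnit
      set y : Ω → I → ℝ := fun ω i' => (A *ᵥ X ω) i' - ∑ j, W.indicator (A i') j * X ω j with hy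
      have hBy : ∀ ω, B *ᵥ (fun i' : I => X ω i') = y ω := by
        intro ω
        ext i'
        have hV0 : ∑ j, V.indicator (A i') j * X ω j = 0 :=
          Finset.sum_eq_zero fun j _ => by
            by_cases hj : j ∈ V
            · simp [h i' i'.2 j hj]
            · simp [hj]
        simp only [hy]
        rw [hdecomp, hV0, add_zero, add_sub_cancel_right]
        simp only [mulVec, dotProduct, hB, submatrix_apply, Set.indicator_apply, ite_mul, zero_mul]
        rw [← Finset.sum_filter]
        exact (Finset.sum_subtype _ (by simp) (fun j => A i' j * X ω j)).symm
      have hXi : (fun ω => X ω i) = fun ω => (B⁻¹ *ᵥ y ω) ⟨i, hi⟩ := by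
        ext ω
        rw [← hBy, mulVec_mulVec, nonsing_inv_mul _ hBu, one_mulVec]
      rw [hXi]
      simp only [mulVec, dotProduct]
      refine Finset.measurable_sum _ fun i' _ => Measurable.const_mul (Measurable.sub ?_ ?_) _
      · exact (measurable_sigmaCoords (fun ω => A *ᵥ X ω) i'.2).mono le_sup_right le_rfl
      · exact (measurable_sum_indicator_mul X W (A i')).mono le_sup_left le_rfl

end Gaussian

/-! ### Stacked sequences and block precision matrices -/

section BlockVector

variable {Ω : Type*} {mΩ : MeasurableSpace Ω} {P : Measure Ω} {N d : ℕ}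

/-- The states at the times `0, …, N` stacked into one vector. -/
def stackStates (N : ℕ) {d : ℕ} (x : ℕ → Ω → (Fin d → ℝ)) (ω : Ω) : Fin (N + 1) × Fin d → ℝ :=
  fun p => x p.1 ω p.2

theorem sigmaStates_eq_sigmaCoords (x : ℕ → Ω → (Fin d → ℝ)) {S : Set ℕ} (hS : ∀ k ∈ S, k ≤ N) :
    sigmaStates x S =
      sigmaCoords (stackStates N x) {p : Fin (N + 1) × Fin d | (p.1 : ℕ) ∈ S} := by
  have h : ∀ k, MeasurableSpace.comap (x k) inferInstance =
      ⨆ i, MeasurableSpace.comap (fun ω => x k ω i) inferInstance :=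
    fun k => comap_pi_eq_iSup fun i ω => x k ω i
  refine le_antisymm (iSup₂_le fun k hk => ?_) (iSup₂_le fun p hp => ?_)
  · rw [h]
    refine iSup_le fun i => ?_
    exact le_iSup₂_of_le (f := fun (p : Fin (N + 1) × Fin d)
      (_ : p ∈ {p : Fin (N + 1) × Fin d | (p.1 : ℕ) ∈ S}) =>
        MeasurableSpace.comap (fun ω => stackStates N x ω p) inferInstance)
      (⟨k, Nat.lt_succ_of_le (hS k hk)⟩, i) hk le_rfl
  · refine le_iSup₂_of_le (p.1 : ℕ) hp ?_
    rw [h]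
    exact le_iSup (fun i => MeasurableSpace.comap (fun ω => x p.1 ω i) inferInstance) p.2

theorem comp_mulVec_apply {I J K L : Type*} [Fintype J] [Fintype L]
    (F : Matrix I J (Matrix K L ℝ)) (v : J × L → ℝ) (p : I × K) :
    (Matrix.comp I J K L ℝ F *ᵥ v) p = (∑ m, F p.1 m *ᵥ fun j => v (m, j)) p.2 := by
  simp only [mulVec, dotProduct, comp_apply, Fintype.sum_prod_type, Finset.sum_apply]

theorem comp_mul {I J : Type*} [Fintype I] [Fintype J] [DecidableEq I] [DecidableEq J]
    (F G : Matrix I I (Matrix J J ℝ)) :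
    Matrix.comp I I J J ℝ (F * G) = Matrix.comp I I J J ℝ F * Matrix.comp I I J J ℝ G :=
  (Matrix.compRingEquiv I J ℝ).map_mul F G

/-- The precision matrix `F' S⁻¹ F`, in blocks, of a vector `x` for which `F x` is white with
covariances `S k`. -/
noncomputable def blockPrecision {I J : Type*} [Fintype I] [Fintype J] [DecidableEq I]
    [DecidableEq J] (F : Matrix I I (Matrix J J ℝ)) (S : I → Matrix J J ℝ) :
    Matrix I I (Matrix J J ℝ) :=
  (F.map (·ᵀ))ᵀ * (diagonal fun k => (S k)⁻¹) * F

theorem blockPrecision_apply {I J : Type*} [Fintype I] [Fintype J] [DecidableEq I]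
    [DecidableEq J] (F : Matrix I I (Matrix J J ℝ)) (S : I → Matrix J J ℝ) (k m : I) :
    blockPrecision F S k m = ∑ n, (F n k)ᵀ * (S n)⁻¹ * F n m := by
  simp [blockPrecision, mul_apply, diagonal_apply]

theorem comp_blockPrecision {I J : Type*} [Fintype I] [Fintype J] [DecidableEq I]
    [DecidableEq J] (F : Matrix I I (Matrix J J ℝ)) (S : I → Matrix J J ℝ) :
    Matrix.comp I I J J ℝ (blockPrecision F S) = (Matrix.comp I I J J ℝ F)ᵀ *
      Matrix.comp I I J J ℝ (diagonal fun k => (S k)⁻¹) * Matrix.comp I I J J ℝ F := by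
  rw [blockPrecision, comp_mul, comp_mul]
  rfl

theorem comp_diagonal_mul_inv {I J : Type*} [Fintype I] [Fintype J] [DecidableEq I]
    [DecidableEq J] {S : I → Matrix J J ℝ} (hS : ∀ k, (S k).PosDef) :
    Matrix.comp I I J J ℝ (diagonal fun k => (S k)⁻¹) *
      Matrix.comp I I J J ℝ (diagonal S) = 1 := by
  rw [← comp_mul, diagonal_mul_diagonal, ← comp_one]
  congr 1
  rw [← diagonal_one]
  congr 1
  ext1 k
  exact nonsing_inv_mul _ (hS k).det_pos.ne'.isUnit

theorem posDef_comp_diagonal {I J : Type*} [Fintype I] [Fintype J] [DecidableEq I]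
    [DecidableEq J] {S : I → Matrix J J ℝ} (hS : ∀ k, (S k).PosDef) :
    (Matrix.comp I I J J ℝ (diagonal S)).PosDef := by
  refine PosDef.of_dotProduct_mulVec_pos ?_ fun v hv => ?_
  · ext ⟨k, i⟩ ⟨m, j⟩
    by_cases hkm : k = m
    · subst hkm
      simpa using (hS k).1.apply i j
    · simp [diagonal_apply_ne _ hkm, diagonal_apply_ne _ (Ne.symm hkm)]
  · have hsum : star v ⬝ᵥ (Matrix.comp I I J J ℝ (diagonal S) *ᵥ v) =
        ∑ k, (fun i => v (k, i)) ⬝ᵥ (S k *ᵥ fun i => v (k, i)) := by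
      simp only [dotProduct, Fintype.sum_prod_type, comp_mulVec_apply, Finset.sum_apply,
        Pi.star_apply, star_trivial]
      refine Finset.sum_congr rfl fun k _ => Finset.sum_congr rfl fun i _ => ?_
      rw [Finset.sum_eq_single k (fun m _ hm => by simp [diagonal_apply_ne _ hm.symm]) (by simp)]
      simp
    rw [hsum]
    obtain ⟨⟨k, i⟩, hki⟩ := Function.ne_iff.1 hv
    refine Finset.sum_pos' (fun m _ => ?_) ⟨k, Finset.mem_univ k, ?_⟩
    · simpa using (hS m).posSemidef.dotProduct_mulVec_nonneg fun i => v (m, i)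
    · simpa using (hS k).dotProduct_mulVec_pos (x := fun i => v (k, i)) fun h0 => hki (congrFun h0 i)

theorem posDef_comp_blockPrecision {I J : Type*} [Fintype I] [Fintype J] [DecidableEq I]
    [DecidableEq J] {F : Matrix I I (Matrix J J ℝ)} {S : I → Matrix J J ℝ}
    (hS : ∀ k, (S k).PosDef) (hF : IsUnit (Matrix.comp I I J J ℝ F)) :
    (Matrix.comp I I J J ℝ (blockPrecision F S)).PosDef := by
  rw [comp_blockPrecision]
  have h := posDef_comp_diagonal fun k => (hS k).inv
  simpa using h.conjTranspose_mul_mul_same (Matrix.mulVec_injective_of_isUnit hF)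

theorem hasGaussianLaw_stackStates {x : ℕ → Ω → (Fin d → ℝ)}
    (hx : HasGaussianLaw (fun ω (k : Fin (N + 1)) => x k ω) P) :
    HasGaussianLaw (stackStates N x) P :=
  hx.map_fun (F := Fin (N + 1) × Fin d → ℝ)
    (ContinuousLinearMap.pi fun p : Fin (N + 1) × Fin d =>
      (ContinuousLinearMap.proj p.2 : (Fin d → ℝ) →L[ℝ] ℝ) ∘L
        (ContinuousLinearMap.proj p.1 : (Fin (N + 1) → Fin d → ℝ) →L[ℝ] (Fin d → ℝ)))

theorem IsWhiteNG.coordCov_stackStates {e : ℕ → Ω → (Fin d → ℝ)} (he : IsWhiteNG N P e) :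
    coordCov P (stackStates N e) = Matrix.comp _ _ _ _ ℝ
      (diagonal fun k : Fin (N + 1) => covMatrix P (e k)) := by
  ext ⟨k, i⟩ ⟨m, j⟩
  by_cases hkm : k = m
  · subst hkm
    simp [coordCov, stackStates, covMatrix]
  · have := he.white k (Nat.le_of_lt_succ k.2) m (Nat.le_of_lt_succ m.2)
      (fun h => hkm (Fin.ext h)) i j
    simpa [coordCov, stackStates, diagonal_apply_ne _ hkm] using this

theorem coordCov_congr {ι : Type*} {X Y : Ω → ι → ℝ} (h : X =ᵐ[P] Y) :
    coordCov P X = coordCov P Y := by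
  ext i j
  have h' : ∀ i, (fun ω => X ω i) =ᵐ[P] fun ω => Y ω i := fun i => by
    filter_upwards [h] with ω hω
    rw [hω]
  simp only [coordCov, of_apply]
  rw [covariance_congr_right (h' j), covariance_comm, covariance_congr_right (h' i),
    covariance_comm]

variable {x e : ℕ → Ω → (Fin d → ℝ)}
  {F : Matrix (Fin (N + 1)) (Fin (N + 1)) (Matrix (Fin d) (Fin d) ℝ)}

theorem IsWhiteNG.hasGaussianLaw_of_eq_mulVec (he : IsWhiteNG N P e)
    (hF : IsUnit (Matrix.comp _ _ _ _ ℝ F))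
    (hFx : stackStates N e =ᵐ[P] fun ω => Matrix.comp _ _ _ _ ℝ F *ᵥ stackStates N x ω) :
    HasGaussianLaw (stackStates N x) P := by
  let L : (Fin (N + 1) × Fin d → ℝ) →L[ℝ] (Fin (N + 1) × Fin d → ℝ) :=
    LinearMap.toContinuousLinearMap (Matrix.comp _ _ _ _ ℝ F)⁻¹.mulVecLin
  refine ((hasGaussianLaw_stackStates he.gaussian).map_fun L).congr ?_
  filter_upwards [hFx] with ω hω
  change (Matrix.comp _ _ _ _ ℝ F)⁻¹ *ᵥ stackStates N e ω = _
  rw [hω, mulVec_mulVec, nonsing_inv_mul _ ((isUnit_iff_isUnit_det _).1 hF), one_mulVec]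

/-- From F Cov(x) F' = S follows Cov(x) = F⁻¹ S F'⁻¹, whose inverse is F' S⁻¹ F. -/
theorem IsWhiteNG.blockPrecision_mul_coordCov (he : IsWhiteNG N P e)
    (hF : IsUnit (Matrix.comp _ _ _ _ ℝ F))
    (hFx : stackStates N e =ᵐ[P] fun ω => Matrix.comp _ _ _ _ ℝ F *ᵥ stackStates N x ω) :
    Matrix.comp _ _ _ _ ℝ (blockPrecision F fun k : Fin (N + 1) => covMatrix P (e k)) *
      coordCov P (stackStates N x) = 1 := by
  have hS : ∀ k : Fin (N + 1), (covMatrix P (e k)).PosDef :=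
    fun k => he.nonsingular k (Nat.le_of_lt_succ k.2)
  have hXg := he.hasGaussianLaw_of_eq_mulVec hF hFx
  have := hXg.isProbabilityMeasure
  set f := Matrix.comp _ _ _ _ ℝ F with hf
  have hdet : IsUnit fᵀ.det := by
    rw [det_transpose]
    exact (isUnit_iff_isUnit_det _).1 hF
  have h1 : f * coordCov P (stackStates N x) * fᵀ =
      Matrix.comp _ _ _ _ ℝ (diagonal fun k : Fin (N + 1) => covMatrix P (e k)) := by
    rw [← he.coordCov_stackStates, coordCov_congr hFx]
    ext i j
    exact (coordCov_mulVec (memLp_two_coord hXg) f f i j).symm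
  have h2 : f * coordCov P (stackStates N x) = Matrix.comp _ _ _ _ ℝ
      (diagonal fun k : Fin (N + 1) => covMatrix P (e k)) * fᵀ⁻¹ := by
    rw [← h1, Matrix.mul_assoc, mul_nonsing_inv _ hdet, Matrix.mul_one]
  rw [comp_blockPrecision, Matrix.mul_assoc, h2, Matrix.mul_assoc, ← Matrix.mul_assoc _ _ fᵀ⁻¹,
    comp_diagonal_mul_inv hS, Matrix.one_mul, mul_nonsing_inv _ hdet]

/-- If `F x` is white for an invertible `F`, then `x` is reciprocal if and only if all blocks of
its precision matrix at times separated by two other times vanish. -/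
theorem IsWhiteNG.isReciprocal_iff (he : IsWhiteNG N P e) (hx : ∀ k ≤ N, Measurable (x k))
    (hF : IsUnit (Matrix.comp _ _ _ _ ℝ F))
    (hFx : stackStates N e =ᵐ[P] fun ω => Matrix.comp _ _ _ _ ℝ F *ᵥ stackStates N x ω) :
    IsReciprocal N P x ↔ ∀ j l : ℕ, j < l → l ≤ N → ∀ k m : Fin (N + 1), j < k → k < l →
      ((m : ℕ) < j ∨ l < m) →
        blockPrecision F (fun k : Fin (N + 1) => covMatrix P (e k)) k m = 0 := by
  have hXm : Measurable (stackStates N x) := measurable_pi_lambda _ fun p =>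
    (measurable_pi_apply p.2).comp (hx p.1 (Nat.le_of_lt_succ p.1.2))
  refine forall_congr' fun j => forall_congr' fun l => forall_congr' fun hjl =>
    forall_congr' fun hl => ?_
  rw [sigmaStates_eq_sigmaCoords (N := N) x (S := {j, l}) (by rintro k (rfl | rfl) <;> omega),
    sigmaStates_eq_sigmaCoords (N := N) x (S := {k | j < k ∧ k < l})
      (by rintro k ⟨h1, h2⟩; omega),
    sigmaStates_eq_sigmaCoords (N := N) x (S := {k | k ≤ N ∧ (k < j ∨ l < k)})
      (by rintro k ⟨h1, h2⟩; omega),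
    condIndepGiven_iff_precision_eq_zero hXm (he.hasGaussianLaw_of_eq_mulVec hF hFx)
      (posDef_comp_blockPrecision (fun k => he.nonsingular k (Nat.le_of_lt_succ k.2)) hF)
      (he.blockPrecision_mul_coordCov hF hFx)]
  · constructor
    · intro h k m hjk hkl hm
      ext i i'
      exact h (k, i) ⟨hjk, hkl⟩ (m, i') ⟨Nat.le_of_lt_succ m.2, hm⟩
    · rintro h ⟨k, i⟩ ⟨hjk, hkl⟩ ⟨m, i'⟩ ⟨-, hm⟩
      exact congrFun (congrFun (h k m hjk hkl hm) i) i'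
  · refine Set.disjoint_left.2 ?_
    rintro ⟨k, i⟩ ⟨h1, h2⟩ ⟨-, h3⟩
    simp only at h1 h2 h3
    omega
  · refine Set.disjoint_left.2 ?_
    rintro ⟨k, i⟩ ⟨h1, h2⟩ (h3 | h3) <;> simp only [Set.mem_singleton_iff] at h1 h2 h3 <;> omega
  · refine Set.disjoint_left.2 ?_
    rintro ⟨k, i⟩ ⟨-, h2⟩ (h3 | h3) <;> simp only [Set.mem_singleton_iff] at h2 h3 <;> omega
  · rintro ⟨k, i⟩
    have := k.2
    simp only [Set.mem_ofPred_eq, Set.mem_insert_iff, Set.mem_singleton_iff]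
    omega

end BlockVector

/-! ### The model as a linear system, and its reciprocity criterion -/

namespace CMLModel

variable {N d : ℕ}

/-- The block matrix of the coefficients of the states in the equations of a `CM_L` model with the
boundary conditions `x_0 = B0N x_N + e_0` and `x_N = BN0 x_0 + e_N`. -/
def coeff (𝒢 : CMLModel N d) (B0N BN0 : Matrix (Fin d) (Fin d) ℝ) :
    Matrix (Fin (N + 1)) (Fin (N + 1)) (Matrix (Fin d) (Fin d) ℝ) :=
  Matrix.of fun k m =>
    if (k : ℕ) = 0 then (if (m : ℕ) = N then B0N else 0)
    else if (k : ℕ) = N then (if (m : ℕ) = 0 then BN0 else 0)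
    else (if (m : ℕ) = k - 1 then 𝒢.prev k else 0) + (if (m : ℕ) = N then 𝒢.last k else 0)

theorem sum_ite_mulVec (v : ℕ → Fin d → ℝ) (B : Matrix (Fin d) (Fin d) ℝ) {a : ℕ} (ha : a ≤ N) :
    ∑ m : Fin (N + 1), (if (m : ℕ) = a then B else 0) *ᵥ v m = B *ᵥ v a := by
  rw [Finset.sum_eq_single ⟨a, Nat.lt_succ_of_le ha⟩]
  · simp
  · intro m _ hm
    rw [if_neg fun h => hm (Fin.ext h), zero_mulVec]
  · simp

variable (𝒢 : CMLModel N d) (B0N BN0 : Matrix (Fin d) (Fin d) ℝ)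

theorem sum_coeff_zero (v : ℕ → Fin d → ℝ) (k : Fin (N + 1)) (hk : (k : ℕ) = 0) :
    ∑ m, 𝒢.coeff B0N BN0 k m *ᵥ v m = B0N *ᵥ v N := by
  simp only [coeff, of_apply, if_pos hk]
  exact sum_ite_mulVec v B0N le_rfl

theorem sum_coeff_last (hN : 1 ≤ N) (v : ℕ → Fin d → ℝ) (k : Fin (N + 1)) (hk : (k : ℕ) = N) :
    ∑ m, 𝒢.coeff B0N BN0 k m *ᵥ v m = BN0 *ᵥ v 0 := by
  simp only [coeff, of_apply, if_neg (show ¬(k : ℕ) = 0 by omega), if_pos hk]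
  exact sum_ite_mulVec v BN0 (Nat.zero_le N)

theorem sum_coeff_interior (v : ℕ → Fin d → ℝ) (k : Fin (N + 1)) (hk : 1 ≤ (k : ℕ))
    (hkN : (k : ℕ) < N) :
    ∑ m, 𝒢.coeff B0N BN0 k m *ᵥ v m = 𝒢.prev k *ᵥ v (k - 1) + 𝒢.last k *ᵥ v N := by
  simp only [coeff, of_apply, if_neg (show ¬(k : ℕ) = 0 by omega),
    if_neg (show ¬(k : ℕ) = N by omega), add_mulVec, Finset.sum_add_distrib]
  rw [sum_ite_mulVec v _ (show (k : ℕ) - 1 ≤ N by omega), sum_ite_mulVec v _ le_rfl]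

theorem comp_one_sub_coeff_mulVec {Ω : Type*} (x : ℕ → Ω → Fin d → ℝ) (ω : Ω)
    (p : Fin (N + 1) × Fin d) :
    (Matrix.comp _ _ _ _ ℝ (1 - 𝒢.coeff B0N BN0) *ᵥ stackStates N x ω) p =
      (x p.1 ω - ∑ m : Fin (N + 1), 𝒢.coeff B0N BN0 p.1 m *ᵥ x m ω) p.2 := by
  rw [comp_mulVec_apply]
  simp only [stackStates, Matrix.sub_apply, sub_mulVec, Finset.sum_sub_distrib]
  rw [Finset.sum_eq_single p.1 (fun m _ hm => by rw [one_apply_ne hm.symm, zero_mulVec]) (by simp)]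
  rw [one_apply_eq, one_mulVec]

/-- With zero noise, the vanishing boundary matrix kills one endpoint and the other boundary
equation kills the second; the forward recursion then kills all interior states. -/
theorem isUnit_comp_one_sub_coeff (hN : 1 ≤ N) (hB : B0N = 0 ∨ BN0 = 0) :
    IsUnit (Matrix.comp _ _ _ _ ℝ (1 - 𝒢.coeff B0N BN0)) := by
  rw [← Matrix.mulVec_injective_iff_isUnit]
  refine (injective_iff_map_eq_zero (Matrix.comp _ _ _ _ ℝ (1 - 𝒢.coeff B0N BN0)).mulVecLin).2 ?_
  intro w hw
  -- The kernel vector becomes a sequence on a one-point space, so that the row formulas apply.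
  set x : ℕ → Unit → Fin d → ℝ := fun k _ i =>
    if h : k < N + 1 then w (⟨k, h⟩, i) else 0 with hx
  have hxw : stackStates N x () = w := by
    ext p
    simp only [stackStates, hx, dif_pos p.1.2]
  have h : ∀ k : Fin (N + 1), x k () = ∑ m : Fin (N + 1), 𝒢.coeff B0N BN0 k m *ᵥ x m () := by
    intro k
    rw [← sub_eq_zero]
    ext i
    rw [← 𝒢.comp_one_sub_coeff_mulVec B0N BN0 x () (k, i), hxw]
    exact congrFun hw (k, i)
  have h0 : x 0 () = B0N *ᵥ x N () :=
    (h 0).trans (𝒢.sum_coeff_zero B0N BN0 (fun k => x k ()) 0 rfl)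
  have hNN : x N () = BN0 *ᵥ x 0 () :=
    (h (Fin.last N)).trans (𝒢.sum_coeff_last B0N BN0 hN (fun k => x k ()) (Fin.last N) rfl)
  have hz : x 0 () = 0 ∧ x N () = 0 := by
    rcases hB with rfl | rfl
    · rw [zero_mulVec] at h0
      rw [h0, mulVec_zero] at hNN
      exact ⟨h0, hNN⟩
    · rw [zero_mulVec] at hNN
      rw [hNN, mulVec_zero] at h0
      exact ⟨h0, hNN⟩
  have hall : ∀ k, k < N → x k () = 0 := by
    intro k
    induction k with
    | zero => exact fun _ => hz.1
    | succ k ih =>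
      intro hk
      have := (h ⟨k + 1, by omega⟩).trans (𝒢.sum_coeff_interior B0N BN0 (fun k => x k ())
        ⟨k + 1, by omega⟩ (by simp) hk)
      simpa [ih (by omega), hz.2] using this
  rw [← hxw]
  ext ⟨k, i⟩
  rcases Nat.lt_or_ge k N with hk | hk
  · exact congrFun (hall k hk) i
  · have hkN : (k : ℕ) = N := le_antisymm (Nat.le_of_lt_succ k.2) hk
    simp only [stackStates, hkN]
    exact congrFun hz.2 i

/-- Both boundary forms fit one system: the endpoint given by noise alone receives a zero
coefficient matrix. -/
theorem Describes.exists_whiteNG {Ω : Type*} [MeasurableSpace Ω] {P : Measure Ω}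
    {x : ℕ → Ω → (Fin d → ℝ)} {𝒢 : CMLModel N d} (hN : 1 ≤ N) (h : 𝒢.Describes P x) :
    ∃ e B0N BN0, IsWhiteNG N P e ∧ (∀ k, 1 ≤ k → k < N → covMatrix P (e k) = 𝒢.noise k) ∧
      (B0N = 0 ∨ BN0 = 0) ∧ stackStates N e =ᵐ[P] fun ω =>
        Matrix.comp _ _ _ _ ℝ (1 - 𝒢.coeff B0N BN0) *ᵥ stackStates N x ω := by
  obtain ⟨-, e, he, hcov, hint, hbd⟩ := h
  have hint' : ∀ᵐ ω ∂P, ∀ k, 1 ≤ k → k < N →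
      x k ω = 𝒢.prev k *ᵥ x (k - 1) ω + 𝒢.last k *ᵥ x N ω + e k ω := by
    simp only [ae_all_iff]
    exact hint
  obtain ⟨B0N, BN0, hB, h0, hNN⟩ : ∃ B0N BN0 : Matrix (Fin d) (Fin d) ℝ, (B0N = 0 ∨ BN0 = 0) ∧
      (∀ᵐ ω ∂P, x 0 ω = B0N *ᵥ x N ω + e 0 ω) ∧ (∀ᵐ ω ∂P, x N ω = BN0 *ᵥ x 0 ω + e N ω) := by
    rcases hbd with ⟨B, hN', h0'⟩ | ⟨B, h0', hN'⟩
    · exact ⟨B, 0, Or.inr rfl, h0', by simpa using hN'⟩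
    · exact ⟨0, B, Or.inl rfl, by simpa using h0', hN'⟩
  refine ⟨e, B0N, BN0, he, hcov, hB, ?_⟩
  filter_upwards [hint', h0, hNN] with ω hint' h0 hNN
  ext ⟨k, i⟩
  rw [comp_one_sub_coeff_mulVec]
  refine congrFun (?_ : e k ω = x k ω - _) i
  rcases Nat.eq_zero_or_pos k with hk | hk
  · rw [𝒢.sum_coeff_zero B0N BN0 (fun k => x k ω) k hk]
    simp [hk, h0]
  rcases Nat.lt_or_ge k N with hkN | hkN
  · rw [𝒢.sum_coeff_interior B0N BN0 (fun k => x k ω) k hk hkN, hint' k hk hkN]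
    simp
  · have hkN : (k : ℕ) = N := le_antisymm (Nat.le_of_lt_succ k.2) hkN
    rw [𝒢.sum_coeff_last B0N BN0 hN (fun k => x k ω) k hkN]
    simp [hkN, hNN]

theorem one_sub_coeff_interior {k : Fin (N + 1)} (hk : 1 ≤ (k : ℕ)) (hkN : (k : ℕ) < N)
    (m : Fin (N + 1)) :
    (1 - 𝒢.coeff B0N BN0) k m = (if m = k then 1 else 0) -
      ((if (m : ℕ) = k - 1 then 𝒢.prev k else 0) + (if (m : ℕ) = N then 𝒢.last k else 0)) := by
  simp only [Matrix.sub_apply, one_apply, coeff, of_apply, if_neg (show ¬(k : ℕ) = 0 by omega),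
    if_neg (show ¬(k : ℕ) = N by omega), eq_comm (a := k)]

/-- Boundary matrices occupy only columns 0 and N. The condition `k + 1 < N` is needed because row N
is a boundary row. -/
theorem one_sub_coeff_column {k : Fin (N + 1)} (hk : 1 ≤ (k : ℕ)) (hkN : (k : ℕ) < N)
    (n : Fin (N + 1)) :
    (1 - 𝒢.coeff B0N BN0) n k = (if n = k then 1 else 0) +
      (if (n : ℕ) = k + 1 ∧ (k : ℕ) + 1 < N then -𝒢.prev n else 0) := by
  have h1 : ¬(k : ℕ) = N := by omega
  have h2 : ¬(k : ℕ) = 0 := by omega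
  rw [Matrix.sub_apply, one_apply, sub_eq_add_neg]
  congr 1
  simp only [coeff, of_apply, if_neg h1, if_neg h2]
  split_ifs <;> first | omega | simp

theorem blockPrecision_one_sub_coeff (S : Fin (N + 1) → Matrix (Fin d) (Fin d) ℝ)
    {k : Fin (N + 1)} (hk : 1 ≤ (k : ℕ)) (hkN : (k : ℕ) < N) (m : Fin (N + 1)) :
    blockPrecision (1 - 𝒢.coeff B0N BN0) S k m = (S k)⁻¹ * (1 - 𝒢.coeff B0N BN0) k m +
      if h : (k : ℕ) + 1 < N then -((𝒢.prev (k + 1))ᵀ * (S ⟨k + 1, by omega⟩)⁻¹ *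
        (1 - 𝒢.coeff B0N BN0) ⟨k + 1, by omega⟩ m) else 0 := by
  rw [blockPrecision_apply]
  simp only [𝒢.one_sub_coeff_column B0N BN0 hk hkN, transpose_add, Matrix.add_mul,
    Finset.sum_add_distrib]
  congr 1
  · rw [Finset.sum_eq_single k (fun n _ hn => by simp [hn]) (by simp)]
    simp
  · split_ifs with h
    · rw [Finset.sum_eq_single ⟨k + 1, by omega⟩ (fun n _ hn => ?_) (by simp)]
      · simp [h]
      · rw [if_neg fun h' => hn (Fin.ext h'.1)]
        simp
    · simp [h]

/-- The compatibility condition on the parameters of a `CM_L` model that characterizes reciprocal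
sequences: `G_k⁻¹ G_{k,N} = G_{k+1,k}' G_{k+1}⁻¹ G_{k+1,N}` for `1 ≤ k ≤ N - 2`. -/
def IsCompatible (𝒢 : CMLModel N d) : Prop :=
  ∀ k, 1 ≤ k → k + 1 < N →
    (𝒢.noise k)⁻¹ * 𝒢.last k =
      (𝒢.prev (k + 1))ᵀ * ((𝒢.noise (k + 1))⁻¹ * 𝒢.last (k + 1))

/-- A sequence described by a `CM_L` model is reciprocal iff the model is compatible. -/
theorem Describes.isReciprocal_iff {Ω : Type*} [MeasurableSpace Ω] {P : Measure Ω}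
    {x : ℕ → Ω → (Fin d → ℝ)} {𝒢 : CMLModel N d} (hN : 1 ≤ N) (h : 𝒢.Describes P x) :
    IsReciprocal N P x ↔ 𝒢.IsCompatible := by
  obtain ⟨e, B0N, BN0, he, hcov, hB, hFx⟩ := h.exists_whiteNG hN
  rw [he.isReciprocal_iff h.1 (𝒢.isUnit_comp_one_sub_coeff B0N BN0 hN hB) hFx]
  -- The last column is the only place where a block required to be zero can be nonzero.
  have hlast : ∀ k : Fin (N + 1), 1 ≤ (k : ℕ) → (k : ℕ) + 1 < N →
      blockPrecision (1 - 𝒢.coeff B0N BN0) (fun k : Fin (N + 1) => covMatrix P (e k)) k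
        (Fin.last N) = (𝒢.prev (k + 1))ᵀ * ((𝒢.noise (k + 1))⁻¹ * 𝒢.last (k + 1)) -
          (𝒢.noise k)⁻¹ * 𝒢.last k := by
    intro k hk hkN
    have e1 : (1 - 𝒢.coeff B0N BN0) k (Fin.last N) = -𝒢.last k := by
      rw [𝒢.one_sub_coeff_interior B0N BN0 hk (by omega)]
      have h1 : Fin.last N ≠ k := by
        rintro rfl
        simp at hkN
      have h2 : N ≠ (k : ℕ) - 1 := by omega
      simp [h1, h2]
    have e2 : (1 - 𝒢.coeff B0N BN0) ⟨k + 1, by omega⟩ (Fin.last N) = -𝒢.last (k + 1) := by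
      rw [𝒢.one_sub_coeff_interior B0N BN0 (by simp) (by simpa using hkN)]
      have h1 : Fin.last N ≠ ⟨k + 1, by omega⟩ := by
        intro h
        have := congrArg Fin.val h
        simp at this
        omega
      have h2 : N ≠ (k : ℕ) := by omega
      simp [h1, h2]
    rw [𝒢.blockPrecision_one_sub_coeff B0N BN0 _ hk (by omega), dif_pos hkN, e1, e2,
      hcov k hk (by omega), hcov (k + 1) (by omega) hkN]
    simp only [Matrix.mul_neg, neg_neg, Matrix.mul_assoc]
    abel
  constructor
  · intro h k hk hkN
    have h1 := hlast ⟨k, by omega⟩ hk hkN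
    -- The tightest window around k suffices; N lies outside it.
    rw [h (k - 1) (k + 1) (by omega) (by omega) ⟨k, by omega⟩ (Fin.last N) (by simp; omega)
      (by simp) (Or.inr (by simpa using hkN))] at h1
    exact (sub_eq_zero.1 h1.symm).symm
  · intro h j l hjl hl k m hjk hkl hm
    have hk : 1 ≤ (k : ℕ) := by omega
    have hkN : (k : ℕ) < N := by omega
    by_cases hmN : (m : ℕ) = N
    · obtain rfl : m = Fin.last N := Fin.ext hmN
      rw [hlast k hk (by omega), h k hk (by omega), sub_self]
    -- Here m is none of k - 1, k, k + 1, N, so rows k and k + 1 of F both vanish at m.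
    · have h1 : m ≠ k := by
        rintro rfl
        omega
      have h2 : (m : ℕ) ≠ k - 1 := by omega
      have e1 : (1 - 𝒢.coeff B0N BN0) k m = 0 := by
        rw [𝒢.one_sub_coeff_interior B0N BN0 hk hkN]
        simp [h1, h2, hmN]
      rw [𝒢.blockPrecision_one_sub_coeff B0N BN0 _ hk hkN, e1, Matrix.mul_zero, zero_add]
      split_ifs with hkN'
      · have h3 : m ≠ ⟨k + 1, by omega⟩ := by
          intro h
          have := congrArg Fin.val h
          simp at this
          omega
        have e2 : (1 - 𝒢.coeff B0N BN0) ⟨k + 1, by omega⟩ m = 0 := by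
          rw [𝒢.one_sub_coeff_interior B0N BN0 (by simp) (by simpa using hkN')]
          have h4 : (m : ℕ) ≠ k := fun h => h1 (Fin.ext h)
          simp [h3, h4, hmN]
        rw [e2, Matrix.mul_zero, neg_zero]
      · rfl

end CMLModel

/-! ### Woodbury-type identities -/

section InducingIdentities

variable {n : Type*} {G Y : Matrix n n ℝ}

theorem Matrix.PosDef.isUnit_det [Fintype n] [DecidableEq n] {A : Matrix n n ℝ} (hA : A.PosDef) : IsUnit A.det :=
  hA.det_pos.ne'.isUnit

theorem Matrix.PosDef.transpose_eq {A : Matrix n n ℝ} (hA : A.PosDef) : Aᵀ = A := by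
  simpa using hA.1.eq

theorem Matrix.PosDef.add_transpose_mul_mul [Fintype n] (hG : G.PosDef) (hY : Y.PosDef) (H : Matrix n n ℝ) :
    (Y + Hᵀ * G * H).PosDef := by
  refine hY.add_posSemidef ?_
  simpa using hG.posSemidef.conjTranspose_mul_mul_same H

theorem posDef_add_mul_inv_mul [Fintype n] [DecidableEq n] (hG : G.PosDef) (hY : Y.PosDef)
    (H : Matrix n n ℝ) :
    (G + G * H * Y⁻¹ * Hᵀ * G).PosDef := by
  have h := hY.inv.add_transpose_mul_mul hG (Hᵀ * G)
  rw [transpose_mul, transpose_transpose, hG.transpose_eq] at h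
  simpa only [Matrix.mul_assoc] using h

/-- A push-through identity: it exchanges the updated precision Y + H' G H for Y when passing
between the noise covariances of the two models. -/
theorem transpose_mul_add_mul_inv_mul [Fintype n] [DecidableEq n] (hY : Y.PosDef) (H : Matrix n n ℝ) :
    Hᵀ * (G + G * H * Y⁻¹ * Hᵀ * G) = (Y + Hᵀ * G * H) * (Y⁻¹ * Hᵀ * G) := by
  have h : Y * (Y⁻¹ * (Hᵀ * G)) = Hᵀ * G := by
    rw [← Matrix.mul_assoc, mul_nonsing_inv _ hY.isUnit_det, Matrix.one_mul]
  rw [Matrix.add_mul, Matrix.mul_add]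
  simp only [Matrix.mul_assoc, h]

theorem inv_add_mul_inv_mul [Fintype n] [DecidableEq n] (hG : G.PosDef) (hY : Y.PosDef)
    (H : Matrix n n ℝ) :
    (G + G * H * Y⁻¹ * Hᵀ * G)⁻¹ = G⁻¹ - H * (Y + Hᵀ * G * H)⁻¹ * Hᵀ := by
  have hGu := hG.isUnit_det
  have hr : G * G⁻¹ = 1 := mul_nonsing_inv _ hGu
  have hl : G⁻¹ * G = 1 := nonsing_inv_mul _ hGu
  have hl' : ∀ B, G⁻¹ * (G * B) = B := fun B => by rw [← Matrix.mul_assoc, hl, Matrix.one_mul]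
  have hw : Y⁻¹⁻¹ + Hᵀ * G * G⁻¹ * (G * H) = Y + Hᵀ * G * H := by
    rw [nonsing_inv_nonsing_inv _ hY.isUnit_det, Matrix.mul_assoc _ G G⁻¹, hr, Matrix.mul_one,
      Matrix.mul_assoc]
  have h := add_mul_mul_inv_eq_sub G (G * H) Y⁻¹ (Hᵀ * G)
    ((isUnit_iff_isUnit_det _).2 hGu) ((isUnit_iff_isUnit_det _).2 hY.inv.isUnit_det)
    (by rw [hw]; exact (isUnit_iff_isUnit_det _).2 (hG.add_transpose_mul_mul hY H).isUnit_det)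
  rw [hw] at h
  simp only [Matrix.mul_assoc, hl', hr, Matrix.mul_one] at h ⊢
  exact h

end InducingIdentities

/-! ### One-step recursions for M_{N|k} and C_{N|k} -/

namespace MarkovModel

variable {N d : ℕ} (M : MarkovModel N d)

theorem steps_succ' (k n : ℕ) : M.steps k (n + 1) = M.steps (k + 1) n * M.prev (k + 1) := by
  induction n with
  | zero => simp [steps]
  | succ n ih =>
    rw [steps, ih, steps, Matrix.mul_assoc, show k + (n + 1) + 1 = k + 1 + n + 1 by omega]

theorem toLast_last : M.toLast N = 1 := by
  simp [toLast, steps]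

theorem toLast_eq_mul {k : ℕ} (hk : k < N) : M.toLast k = M.toLast (k + 1) * M.prev (k + 1) := by
  rw [toLast, toLast, ← steps_succ', show N - k = N - (k + 1) + 1 by omega]

theorem covToLast_last : M.covToLast N = 0 := by
  simp [covToLast]

theorem covToLast_eq_add {k : ℕ} (hk : k < N) : M.covToLast k =
    M.covToLast (k + 1) + M.toLast (k + 1) * M.noise (k + 1) * (M.toLast (k + 1))ᵀ := by
  rw [covToLast, Finset.sum_eq_sum_Ico_succ_bot hk, add_comm, covToLast]

theorem covToLast_posDef {k : ℕ} (hk : k < N) : (M.covToLast k).PosDef := by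
  obtain ⟨n, hn⟩ : ∃ n, N = k + n + 1 := ⟨N - k - 1, by omega⟩
  induction n generalizing k with
  | zero =>
    obtain rfl : N = k + 1 := hn
    rw [M.covToLast_eq_add hk, covToLast_last, toLast_last]
    simpa using M.noise_posDef (k + 1) (by omega) le_rfl
  | succ n ih =>
    rw [M.covToLast_eq_add hk]
    refine (ih (k := k + 1) (by omega) (by omega)).add_posSemidef ?_
    simpa using (M.noise_posDef (k + 1) (by omega) hk).posSemidef.mul_mul_conjTranspose_same
      (M.toLast (k + 1))

end MarkovModel

/-! ### Compatible models are exactly the induced ones -/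

namespace CMLModel

variable {N d : ℕ} {𝒢 : CMLModel N d}

/-- Woodbury applied to C_{N|k} = C_{N|k+1} + M_{N|k+1} M_{k+1} M_{N|k+1}' has G_{k+1} as its inner
inverse, and the correction term turns M_{k+1,k} into G_{k+1,k}. -/
theorem IsInducedBy.isCompatible {M : MarkovModel N d} (h : 𝒢.IsInducedBy M) :
    𝒢.IsCompatible := by
  have hH : ∀ k, 1 ≤ k → k < N →
      (𝒢.noise k)⁻¹ * 𝒢.last k = (M.toLast k)ᵀ * (M.covToLast k)⁻¹ := by
    intro k hk hkN
    rw [(h k hk hkN).2.1, ← Matrix.mul_assoc, ← Matrix.mul_assoc,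
      nonsing_inv_mul _ (𝒢.noise_posDef k hk hkN).isUnit_det, Matrix.one_mul]
  intro k hk hkN
  have hC := M.covToLast_posDef hkN
  have hG := 𝒢.noise_posDef (k + 1) (by omega) hkN
  have hM := M.noise_posDef (k + 1) (by omega) hkN.le
  obtain ⟨hprev, hlast, hnoise⟩ := h (k + 1) (by omega) hkN
  have hu : IsUnit ((M.noise (k + 1))⁻¹ +
      (M.toLast (k + 1))ᵀ * (M.covToLast (k + 1))⁻¹ * M.toLast (k + 1)) :=
    (isUnit_iff_isUnit_det _).2 (hC.inv.add_transpose_mul_mul hM.inv _).isUnit_det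
  rw [hH k hk (by omega), hH (k + 1) (by omega) hkN, M.toLast_eq_mul (by omega : k < N),
    M.covToLast_eq_add (by omega : k < N), add_mul_mul_inv_eq_sub _ _ _ _
      ((isUnit_iff_isUnit_det _).2 hC.isUnit_det) ((isUnit_iff_isUnit_det _).2 hM.isUnit_det) hu,
    ← hnoise, hprev, hlast]
  simp only [transpose_sub, transpose_mul, transpose_transpose, hG.transpose_eq,
    hC.inv.transpose_eq, Matrix.sub_mul, Matrix.mul_sub, Matrix.mul_assoc]

/-- The matrices `I + ∑_{1 ≤ j ≤ k} G_{j,N}' G_j⁻¹ G_{j,N}`. -/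
noncomputable def tailPrecision (𝒢 : CMLModel N d) (k : ℕ) : Matrix (Fin d) (Fin d) ℝ :=
  -- The 1 is the precision chosen for x_N given x_0; it makes every partial sum with k < N
  -- invertible.
  1 + ∑ j ∈ Finset.range k,
    ((𝒢.noise (j + 1))⁻¹ * 𝒢.last (j + 1))ᵀ * 𝒢.noise (j + 1) *
      ((𝒢.noise (j + 1))⁻¹ * 𝒢.last (j + 1))

theorem tailPrecision_succ (𝒢 : CMLModel N d) (k : ℕ) :
    𝒢.tailPrecision (k + 1) = 𝒢.tailPrecision k +
      ((𝒢.noise (k + 1))⁻¹ * 𝒢.last (k + 1))ᵀ * 𝒢.noise (k + 1) *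
        ((𝒢.noise (k + 1))⁻¹ * 𝒢.last (k + 1)) := by
  rw [tailPrecision, Finset.sum_range_succ, ← add_assoc, tailPrecision]

theorem tailPrecision_posDef (𝒢 : CMLModel N d) {k : ℕ} (hk : k < N) :
    (𝒢.tailPrecision k).PosDef := by
  induction k with
  | zero =>
    rw [tailPrecision]
    simpa using Matrix.PosDef.one
  | succ k ih =>
    rw [tailPrecision_succ]
    exact (𝒢.noise_posDef (k + 1) (by omega) hk).add_transpose_mul_mul (ih (by omega)) _

/-- The covariances of the noise of the Markov model that induces `𝒢`. -/
noncomputable def markovNoise (𝒢 : CMLModel N d) (k : ℕ) : Matrix (Fin d) (Fin d) ℝ :=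
  𝒢.noise k + 𝒢.noise k * ((𝒢.noise k)⁻¹ * 𝒢.last k) * (𝒢.tailPrecision (k - 1))⁻¹ *
    ((𝒢.noise k)⁻¹ * 𝒢.last k)ᵀ * 𝒢.noise k

theorem markovNoise_posDef (𝒢 : CMLModel N d) {k : ℕ} (hk : 1 ≤ k) (hkN : k < N) :
    (𝒢.markovNoise k).PosDef :=
  posDef_add_mul_inv_mul (𝒢.noise_posDef k hk hkN) (𝒢.tailPrecision_posDef (by omega)) _

/-- A Markov model that induces the compatible model `𝒢`. -/
noncomputable def toMarkov (𝒢 : CMLModel N d) : MarkovModel N d where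
  -- The final transition is read off from the conditional law of x_N given x_{N-1}.
  prev k := if k < N then 𝒢.markovNoise k * (𝒢.noise k)⁻¹ * 𝒢.prev k
    else (𝒢.tailPrecision (N - 1))⁻¹ * ((𝒢.noise (N - 1))⁻¹ * 𝒢.last (N - 1))ᵀ
  noise k := if k < N then 𝒢.markovNoise k else (𝒢.tailPrecision (N - 1))⁻¹
  noise_posDef k hk hkN := by
    split_ifs with h
    · exact 𝒢.markovNoise_posDef hk h
    · exact (𝒢.tailPrecision_posDef (by omega)).inv

/-- Downward induction from k = N - 1, where both formulas hold by the choice of the final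
transition. With Y, Z the precisions at k, k + 1, push-through gives Z⁻¹ H' M_{k+1} = Y⁻¹ H'
G_{k+1}. Compatibility then yields the first formula, and Z = Y + H' G_{k+1} H the second. -/
theorem IsCompatible.toLast_toMarkov_and_covToLast_toMarkov (h : 𝒢.IsCompatible) {k : ℕ}
    (hk : 1 ≤ k) (hkN : k < N) :
    𝒢.toMarkov.toLast k = (𝒢.tailPrecision k)⁻¹ * ((𝒢.noise k)⁻¹ * 𝒢.last k)ᵀ ∧
      𝒢.toMarkov.covToLast k = (𝒢.tailPrecision k)⁻¹ := by
  obtain ⟨n, hn⟩ : ∃ n, N = k + n + 1 := ⟨N - k - 1, by omega⟩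
  induction n generalizing k with
  | zero =>
    obtain rfl : N = k + 1 := hn
    rw [MarkovModel.toLast_eq_mul _ hkN, MarkovModel.covToLast_eq_add _ hkN,
      MarkovModel.toLast_last, MarkovModel.covToLast_last]
    simp [toMarkov]
  | succ n ih =>
    obtain ⟨ih1, ih2⟩ := ih (k := k + 1) (by omega) (by omega) (by omega)
    have hk1 : k + 1 < N := by omega
    have hG := 𝒢.noise_posDef (k + 1) (by omega) hk1
    have hY := 𝒢.tailPrecision_posDef hkN
    have hZ := 𝒢.tailPrecision_posDef hk1
    have hM := 𝒢.markovNoise_posDef (by omega) hk1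
    rw [MarkovModel.toLast_eq_mul _ hkN, MarkovModel.covToLast_eq_add _ hkN, ih1, ih2]
    simp only [toMarkov, if_pos hk1]
    have hcomp := congrArg Matrix.transpose (h k hk hk1)
    rw [transpose_mul _ (_ * _), transpose_transpose] at hcomp
    have hsucc := 𝒢.tailPrecision_succ k
    have key := transpose_mul_add_mul_inv_mul (G := 𝒢.noise (k + 1)) hY
      ((𝒢.noise (k + 1))⁻¹ * 𝒢.last (k + 1))
    rw [← hsucc] at key
    have key' : ((𝒢.noise (k + 1))⁻¹ * 𝒢.last (k + 1))ᵀ * 𝒢.markovNoise (k + 1) = _ := key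
    rw [hcomp]
    set H := (𝒢.noise (k + 1))⁻¹ * 𝒢.last (k + 1)
    set G := 𝒢.noise (k + 1)
    set Y := 𝒢.tailPrecision k
    set Z := 𝒢.tailPrecision (k + 1)
    have hZc : ∀ B, Z⁻¹ * (Z * B) = B := fun B => by
      rw [← Matrix.mul_assoc, nonsing_inv_mul _ hZ.isUnit_det, Matrix.one_mul]
    have hZM : Z⁻¹ * Hᵀ * 𝒢.markovNoise (k + 1) = Y⁻¹ * Hᵀ * G := by
      rw [Matrix.mul_assoc, key', hZc]
    constructor
    · rw [← Matrix.mul_assoc, ← Matrix.mul_assoc (Z⁻¹ * Hᵀ), hZM, Matrix.mul_assoc _ G,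
        mul_nonsing_inv _ hG.isUnit_det, Matrix.mul_one, Matrix.mul_assoc]
    · rw [hZM, transpose_mul Z⁻¹ Hᵀ, transpose_transpose, hZ.inv.transpose_eq]
      have h1 : Y⁻¹ * Hᵀ * G * (H * Z⁻¹) = Y⁻¹ * (Hᵀ * G * H) * Z⁻¹ := by
        simp only [Matrix.mul_assoc]
      have h2 : Y⁻¹ * Z = 1 + Y⁻¹ * (Hᵀ * G * H) := by
        rw [hsucc, Matrix.mul_add, nonsing_inv_mul _ hY.isUnit_det]
      calc Z⁻¹ + Y⁻¹ * Hᵀ * G * (H * Z⁻¹) = (1 + Y⁻¹ * (Hᵀ * G * H)) * Z⁻¹ := by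
            rw [h1, Matrix.add_mul, Matrix.one_mul]
        _ = Y⁻¹ := by
            rw [← h2, Matrix.mul_assoc, mul_nonsing_inv _ hZ.isUnit_det, Matrix.mul_one]

theorem IsCompatible.isInducedBy_toMarkov (h : 𝒢.IsCompatible) :
    𝒢.IsInducedBy 𝒢.toMarkov := by
  intro k hk hkN
  obtain ⟨h1, h2⟩ := h.toLast_toMarkov_and_covToLast_toMarkov hk hkN
  obtain ⟨k, rfl⟩ : ∃ n, k = n + 1 := ⟨k - 1, by omega⟩
  have hG := 𝒢.noise_posDef (k + 1) hk hkN
  have hY := 𝒢.tailPrecision_posDef (by omega : k < N)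
  have hZ := 𝒢.tailPrecision_posDef hkN
  have hM := 𝒢.markovNoise_posDef hk hkN
  have hinv : (𝒢.markovNoise (k + 1))⁻¹ = _ :=
    inv_add_mul_inv_mul hG hY ((𝒢.noise (k + 1))⁻¹ * 𝒢.last (k + 1))
  rw [← 𝒢.tailPrecision_succ k] at hinv
  have hlast : 𝒢.noise (k + 1) * ((𝒢.noise (k + 1))⁻¹ * 𝒢.last (k + 1)) = 𝒢.last (k + 1) := by
    rw [← Matrix.mul_assoc, mul_nonsing_inv _ hG.isUnit_det, Matrix.one_mul]
  rw [h1, h2]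
  simp only [toMarkov, if_pos hkN]
  set H := (𝒢.noise (k + 1))⁻¹ * 𝒢.last (k + 1)
  set Z := 𝒢.tailPrecision (k + 1)
  rw [transpose_mul Z⁻¹ Hᵀ, transpose_transpose, hZ.inv.transpose_eq,
    nonsing_inv_nonsing_inv _ hZ.isUnit_det]
  have hZc : Z⁻¹ * Z = 1 := nonsing_inv_mul _ hZ.isUnit_det
  -- G_k M_k⁻¹ = I - G_{k,N} M_{N|k}: this factor undoes the M_k G_k⁻¹ in the Markov transition.
  have hG' : 𝒢.noise (k + 1) * (𝒢.markovNoise (k + 1))⁻¹ = 1 - 𝒢.last (k + 1) * (Z⁻¹ * Hᵀ) := by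
    rw [hinv, Matrix.mul_sub, mul_nonsing_inv _ hG.isUnit_det, ← hlast]
    simp only [Matrix.mul_assoc]
  refine ⟨?_, ?_, ?_⟩
  · have h3 : ∀ B, B - 𝒢.last (k + 1) * (Z⁻¹ * Hᵀ) * B =
        𝒢.noise (k + 1) * (𝒢.markovNoise (k + 1))⁻¹ * B := fun B => by
      rw [hG', Matrix.sub_mul, Matrix.one_mul]
    rw [h3, ← Matrix.mul_assoc, Matrix.mul_assoc (𝒢.noise (k + 1)), ← Matrix.mul_assoc _⁻¹,
      nonsing_inv_mul _ hM.isUnit_det, Matrix.one_mul, mul_nonsing_inv _ hG.isUnit_det,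
      Matrix.one_mul]
  · rw [Matrix.mul_assoc, Matrix.mul_assoc H, hZc, Matrix.mul_one, hlast]
  · have h4 : H * Z⁻¹ * Z * (Z⁻¹ * Hᵀ) = H * Z⁻¹ * Hᵀ := by
      rw [Matrix.mul_assoc H, hZc, Matrix.mul_one, ← Matrix.mul_assoc H Z⁻¹ Hᵀ]
    rw [hinv, h4, sub_add_cancel, nonsing_inv_nonsing_inv _ hG.isUnit_det]

theorem isCompatible_iff_exists_isInducedBy :
    𝒢.IsCompatible ↔ ∃ M : MarkovModel N d, 𝒢.IsInducedBy M :=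
  ⟨fun h => ⟨𝒢.toMarkov, h.isInducedBy_toMarkov⟩, fun ⟨_, h⟩ => h.isCompatible⟩

end CMLModel

/-! ### Existence of described sequences -/

namespace CMLModel

variable {N d : ℕ}

/-- There are white Gaussian sequences with arbitrary nonsingular covariances. -/
theorem exists_isWhiteNG (N : ℕ) {d : ℕ} (S : ℕ → Matrix (Fin d) (Fin d) ℝ)
    (hS : ∀ k ≤ N, (S k).PosDef) :
    ∃ (Ω : Type) (_ : MeasurableSpace Ω) (P : Measure Ω) (_ : IsProbabilityMeasure P)
      (e : ℕ → Ω → (Fin d → ℝ)), (∀ k, Measurable (e k)) ∧ IsWhiteNG N P e ∧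
        ∀ k ≤ N, covMatrix P (e k) = S k := by
  set C : Matrix (Fin (N + 1) × Fin d) (Fin (N + 1) × Fin d) ℝ :=
    Matrix.comp _ _ _ _ ℝ (diagonal fun k : Fin (N + 1) => S k) with hC
  have hCpos : C.PosSemidef :=
    (posDef_comp_diagonal fun k : Fin (N + 1) => hS k (Nat.le_of_lt_succ k.2)).posSemidef
  set P := multivariateGaussian (0 : EuclideanSpace ℝ (Fin (N + 1) × Fin d)) C with hP
  set e : ℕ → EuclideanSpace ℝ (Fin (N + 1) × Fin d) → (Fin d → ℝ) :=
    fun k ω i => if h : k < N + 1 then ω (⟨k, h⟩, i) else 0 with he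
  have hek : ∀ k (h : k ≤ N) i, (fun ω => e k ω i) = fun ω => ω (⟨k, Nat.lt_succ_of_le h⟩, i) :=
    fun k h i => by simp only [he, dif_pos (Nat.lt_succ_of_le h)]
  have hcov : ∀ k ≤ N, ∀ l ≤ N, ∀ i j, cov[fun ω => e k ω i, fun ω => e l ω j; P] =
      if k = l then S k i j else 0 := by
    intro k hk l hl i j
    rw [hek k hk, hek l hl, covariance_eval_multivariateGaussian hCpos, hC, comp_apply,
      diagonal_apply]
    simp only [Fin.mk.injEq]
    split_ifs <;> rfl
  have hcovM : ∀ k ≤ N, covMatrix P (e k) = S k := by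
    intro k hk
    ext i j
    simp [covMatrix, hcov k hk k hk]
  refine ⟨_, inferInstance, P, inferInstance, e, fun k => ?_, ⟨?_, ?_, ?_, ?_⟩, hcovM⟩
  · refine measurable_pi_lambda _ fun i => ?_
    simp only [he]
    split_ifs
    · fun_prop
    · exact measurable_const
  · have h : HasGaussianLaw (id : EuclideanSpace ℝ (Fin (N + 1) × Fin d) → _) P :=
      IsGaussian.hasGaussianLaw_id
    have h' := h.map_fun (F := Fin (N + 1) → Fin d → ℝ) (ContinuousLinearMap.pi fun k =>
      ContinuousLinearMap.pi fun i => EuclideanSpace.proj (k, i))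
    refine h'.congr (Filter.Eventually.of_forall fun ω => ?_)
    ext k i
    simp only [he, dif_pos k.2]
    rfl
  · intro k hk i
    rw [hek k hk i]
    have h := ContinuousLinearMap.integral_comp_id_comm (μ := P) IsGaussian.integrable_id
      (EuclideanSpace.proj (𝕜 := ℝ) ((⟨k, Nat.lt_succ_of_le hk⟩, i) : Fin (N + 1) × Fin d))
    rw [hP, integral_id_multivariateGaussian] at h
    simpa using h
  · intro k hk l hl hkl i j
    rw [hcov k hk l hl, if_neg hkl]
  · intro k hk
    rw [hcovM k hk]
    exact hS k hk

/-- Every `CM_L` model describes some sequence. -/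
theorem exists_describes (hN : 1 ≤ N) (𝒢 : CMLModel N d) :
    ∃ (Ω : Type) (_ : MeasurableSpace Ω) (P : Measure Ω) (_ : IsProbabilityMeasure P)
      (x : ℕ → Ω → (Fin d → ℝ)), 𝒢.Describes P x := by
  obtain ⟨Ω, mΩ, P, hP, e, hem, he, hcov⟩ := exists_isWhiteNG N
    -- The endpoint covariances are free; the identity is used.
    (fun k => if 1 ≤ k ∧ k < N then 𝒢.noise k else 1) (fun k _ => by
      split_ifs with h
      · exact 𝒢.noise_posDef k h.1 h.2
      · exact Matrix.PosDef.one)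
  -- The final state is fixed first, since every interior equation refers to it; x_0 = e_0
  -- corresponds to G_{0,N} = 0.
  let x : ℕ → Ω → (Fin d → ℝ) := fun k ω => if k = N then e N ω else
    Nat.rec (e 0 ω) (fun k y => 𝒢.prev (k + 1) *ᵥ y + 𝒢.last (k + 1) *ᵥ e N ω + e (k + 1) ω) k
  have hxN : x N = e N := by
    ext1 ω
    simp [x]
  have hx0 : x 0 = e 0 := by
    ext1 ω
    simp [x, show 0 ≠ N by omega]
  have hxs : ∀ k, k + 1 < N → x (k + 1) = fun ω =>
      𝒢.prev (k + 1) *ᵥ x k ω + 𝒢.last (k + 1) *ᵥ x N ω + e (k + 1) ω := by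
    intro k hk
    ext1 ω
    simp [x, show k ≠ N by omega, show k + 1 ≠ N by omega]
  have hmul : ∀ (A : Matrix (Fin d) (Fin d) ℝ) {y : Ω → Fin d → ℝ}, Measurable y →
      Measurable fun ω => A *ᵥ y ω := fun A y hy =>
    (LinearMap.continuous_of_finiteDimensional A.mulVecLin).measurable.comp hy
  have hxm : ∀ k, k < N → Measurable (x k) := by
    intro k
    induction k with
    | zero => exact fun _ => hx0 ▸ hem 0
    | succ k ih =>
      intro hk
      rw [hxs k hk]
      exact ((hmul _ (ih (by omega))).add (hmul _ (hxN ▸ hem N))).add (hem _)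
  refine ⟨Ω, mΩ, P, hP, x, fun k hk => ?_, e, he, fun k hk hkN => ?_, fun k hk hkN => ?_,
    Or.inl ⟨0, ?_, ?_⟩⟩
  · rcases hk.lt_or_eq with h | rfl
    · exact hxm k h
    · exact hxN ▸ hem k
  · rw [hcov k hkN.le, if_pos ⟨hk, hkN⟩]
  · obtain ⟨k, rfl⟩ : ∃ n, k = n + 1 := ⟨k - 1, by omega⟩
    exact Filter.Eventually.of_forall fun ω => congrFun (hxs k hkN) ω
  · exact Filter.Eventually.of_forall fun ω => congrFun hxN ω
  · exact Filter.Eventually.of_forall fun ω => by rw [hx0, zero_mulVec, zero_add]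

end CMLModel

theorem mainTheorem10 (N d : ℕ) (hN : 1 ≤ N) (𝒢 : CMLModel N d) :
    ((∃ (Ω : Type) (_ : MeasurableSpace Ω) (P : Measure Ω) (_ : IsProbabilityMeasure P)
        (x : ℕ → Ω → (Fin d → ℝ)), 𝒢.Describes P x ∧ IsReciprocal N P x) ↔
      ∃ M : MarkovModel N d, 𝒢.IsInducedBy M) ∧
    (∀ (Ω : Type*) [MeasurableSpace Ω] (P : Measure Ω) [IsProbabilityMeasure P]
        (x : ℕ → Ω → (Fin d → ℝ)), 𝒢.Describes P x →
      (IsReciprocal N P x ↔ ∃ M : MarkovModel N d, 𝒢.IsInducedBy M)) := by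
  rw [← CMLModel.isCompatible_iff_exists_isInducedBy]
  refine ⟨⟨?_, fun h => ?_⟩, fun Ω _ P _ x hx => hx.isReciprocal_iff hN⟩
  · rintro ⟨Ω, _, P, _, x, hx, hr⟩
    exact (hx.isReciprocal_iff hN).1 hr
  · obtain ⟨Ω, mΩ, P, hP, x, hx⟩ := 𝒢.exists_describes hN
    exact ⟨Ω, mΩ, P, hP, x, hx, (hx.isReciprocal_iff hN).2 h⟩
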